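/- A \emph{set-sequence equipped with embeddings} (ssee) $\mathbf V$ is a sequence $(V_n)_{n\in\mathbb N}$ of finite sets together with, for all $N\le n$, a collection $\binom{V_n}{V_N}$ of injections $\phi:V_N\to V_n$, called embeddings. Let $I(N,n)$ be the number of ordered pairs $(\phi,\psi)$ of embeddings in $\binom{V_n}{V_N}$ with $1<|\phi(V_N)\cap\psi(V_N)|<|V_N|$. The ssee $\mathbf V$ is \emph{good} if $|V_n|\to\infty$ and, for every $N$ with $|V_N|>1$, as $n\to\infty$ \[ \frac{\bigl|\binom{V_n}{V_N}\bigr|}{|V_n|}\to\infty \qquad\text{and}\qquad \frac{|V_n|\,I(N,n)}{\bigl|\binom{V_n}{V_N}\bigr|^2}\to 0 . \] It is \emph{homogeneous} if for all $N\le n$ with $V_N\neq\emptyset$ there is an integer $k>0$ such that every $x\in V_n$ belongs to $\phi(V_N)$ for exactly $k$ embeddings $\phi\in\binom{V_n}{V_N}$. A \emph{$[0,1]$-decoration property} of $\mathbf V$ is a sequence $\mathcal P=(\mathcal P_n)_{n\in\mathbb N}$ of Lebesgue measurable sets $\mathcal P_n\subseteq[0,1]^{V_n}$. It is \emph{hereditary}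 if for all $N\le n$, $\phi\in\binom{V_n}{V_N}$ and $c\in[0,1]^{V_n}$ with $c\circ\phi\notin\mathcal P_N$, one has $c\notin\mathcal P_n$. A \emph{box} in $V_n$ is a product $b=\prod_{i\in V_n}A_i$ of measurable sets $A_i\subseteq[0,1]$. Write $\mathrm{vol}$ for Lebesgue measure on $[0,1]^{V_n}$, and set \[ \mathrm{ex}(V_n,\mathcal P_n):=\inf\{-\log \mathrm{vol}(b)\;:\; b \text{ a box in } V_n,\ \mathrm{vol}(b\setminus\mathcal P_n)=0\}\in[0,\infty], \qquad -\log 0:=\infty . \] \textbf{Theorem.} Let $\mathbf V$ be a good homogeneous ssee and let $\mathcal P$ be a hereditary $[0,1]$-decoration property of $\mathbf V$. Then one of the following holds: \begin{enumerate} \item[(a)] the limit $\pi(\mathcal P)=\lim_{n\to\infty}\mathrm{ex}(V_n,\mathcal P_n)/|V_n|$ exists and is finite, and \[ \mathrm{vol}(\mathcal P_n)=e^{-(\pi(\mathcal P)+o(1))|V_n|}\quad\text{as } n\to\infty ; \] \item[(b)] $\mathrm{ex}(V_n,\mathcal P_n)/|V_n|\to\infty$ as $n\to\infty$, and $\mathrm{vol}(\mathcal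 P_n)\le e^{-\omega(|V_n|)}$; that is, there are reals $w_n$ with $w_n/|V_n|\to\infty$ and $\mathrm{vol}(\mathcal P_n)\le e^{-w_n}$ for all sufficiently large $n$. \end{enumerate} -/

import Mathlib

open Filter Topology MeasureTheory

universe u

/-- A set-sequence equipped with embeddings (ssee): finite sets `V 0, V 1, V 2, …` and, for `N ≤ n`,
a collection `emb N n` of injections from `V N` to `V n`.
(The collections `emb N n` with `n < N` play no role in what follows.) -/
structure SSEE where
  V : ℕ → Type u
  [fintypeV : ∀ n, Fintype (V n)]
  emb : ∀ N n : ℕ, Finset (V N ↪ V n)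

attribute [instance] SSEE.fintypeV

namespace SSEE

noncomputable section

/-- The number of `i`-intersecting embeddings of `(V N₁, V N₂)` into `V n`. A map on the disjoint
union `V N₁ ⊔ V N₂` is given by the pair of its restrictions to `V N₁` and `V N₂`. -/
def intersecting (S : SSEE.{u}) (i N₁ N₂ n : ℕ) : ℕ :=
  Set.ncard {p : (S.V N₁ ↪ S.V n) × (S.V N₂ ↪ S.V n) |
    p.1 ∈ S.emb N₁ n ∧ p.2 ∈ S.emb N₂ n ∧ (Set.range p.1 ∩ Set.range p.2).ncard = i}

/-- `I(N, n)`, the number of pairs of embeddings of `V N` into `V n` whose images share more than one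
and fewer than `|V N|` elements. -/
def totalIntersecting (S : SSEE.{u}) (N n : ℕ) : ℕ :=
  ∑ i ∈ Finset.Ioo 1 (Fintype.card (S.V N)), S.intersecting i N N n

structure IsGood (S : SSEE.{u}) : Prop where
  card_tendsto : Tendsto (fun n => Fintype.card (S.V n)) atTop atTop
  many_embeddings : ∀ N, 1 < Fintype.card (S.V N) →
    Tendsto (fun n => ((S.emb N n).card : ℝ) / (Fintype.card (S.V n) : ℝ)) atTop atTop
  few_intersections : ∀ N, 1 < Fintype.card (S.V N) →
    Tendsto (fun n => ((Fintype.card (S.V n) : ℝ) * (S.totalIntersecting N n : ℝ))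
      / ((S.emb N n).card : ℝ) ^ 2) atTop (𝓝 0)

/-- For `N ≤ n`, every element of `V n` lies in the image of the same, strictly positive number of
embeddings of `V N`. Indices `N` with `V N = ∅` are exempt: no element lies in the image of the
empty map. -/
def IsHomogeneous (S : SSEE.{u}) : Prop :=
  ∀ N n : ℕ, N ≤ n → Nonempty (S.V N) →
    ∃ k : ℕ, 0 < k ∧ ∀ x : S.V n, Set.ncard {φ | φ ∈ S.emb N n ∧ x ∈ Set.range φ} = k

/-- The set `[0,1]^(V n)` of `[0,1]`-decorations of `V n`; its `volume` is Lebesgue measure. -/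
abbrev Decoration (S : SSEE.{u}) (n : ℕ) : Type u := S.V n → unitInterval

/-- The `φ`-lift of a body `b ⊆ [0,1]^(V N)`. -/
def lift (S : SSEE.{u}) {N n : ℕ} (φ : S.V N ↪ S.V n) (b : Set (S.Decoration N)) :
    Set (S.Decoration n) :=
  {c | ∃ c' ∈ b, ∀ i, c' i = c (φ i)}

/-- The upper shadow in `[0,1]^(V n)` of a body `b ⊆ [0,1]^(V N)`. -/
def upperShadow (S : SSEE.{u}) {N : ℕ} (n : ℕ) (b : Set (S.Decoration N)) :
    Set (S.Decoration n) :=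
  ⋃ φ ∈ S.emb N n, S.lift φ b

/-- A `[0,1]`-decoration property: a sequence of Lebesgue measurable sets `P n ⊆ [0,1]^(V n)`.
(Null-measurable for `volume` is the same as Lebesgue measurable.) -/
structure DecorationProperty (S : SSEE.{u}) where
  body : ∀ n, Set (S.Decoration n)
  measurable_body : ∀ n, NullMeasurableSet (body n) volume

/-- The complement of a hereditary property is closed under taking upper shadows. -/
def DecorationProperty.IsHereditary {S : SSEE.{u}} (P : S.DecorationProperty) : Prop :=
  ∀ N n : ℕ, N ≤ n → S.upperShadow n (P.body N)ᶜ ⊆ (P.body n)ᶜ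

/-- Boxes: products of Lebesgue measurable subsets of `[0,1]`. -/
def boxes (S : SSEE.{u}) (n : ℕ) : Set (Set (S.Decoration n)) :=
  {b | ∃ A : S.V n → Set unitInterval,
    (∀ i, NullMeasurableSet (A i) volume) ∧ b = Set.univ.pi A}

/-- The entropy `-log vol(b)`, with value `+∞` when `vol(b) = 0`. -/
def entropy (S : SSEE.{u}) {n : ℕ} (b : Set (S.Decoration n)) : EReal :=
  -ENNReal.log (volume b)

/-- The extremal entropy `ex(V n, P n)`, an element of `[0, +∞]`. -/
def extremalEntropy (S : SSEE.{u}) (P : S.DecorationProperty) (n : ℕ) : EReal :=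
  sInf {e | ∃ b ∈ S.boxes n, volume (b \ P.body n) = 0 ∧ e = S.entropy b}

end

end SSEE

/-!
Since a box almost contained in `P n` has volume at most that of `P n`, the extremal entropy is at
least `-log vol (P n)`. Conversely, fix a large `N` and let `m < ex (V N, P N)`, so that every box
almost contained in `P N` has volume less than `exp (-m)`. Boxes form a compact family with respect
to setwise limits of the measures `vol (A ∩ ·)` of their sides `A`, so the same bound holds, for
some `κ > 0`, for all boxes `b` with `vol (b \ P N) ≤ κ`. Colour `[0,1]` with finitely many colours
so that the complement of `P N` is nearly a set `Q` of colour patterns, and take a random point of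
`P n`. No embedding of `V N` sees a point outside `P N`; by Finner's inequality, applied to
exponential moments, only a small proportion of the embeddings sees a pattern in `Q`, unless `P n`
is already small enough.

Revealing the colours on a small set of vertices that maximizes an energy makes the colours along
most embeddings nearly independent. Let the container of a vertex consist of the colours that
keep conditional density at least `θ`. Along most embeddings the box of containers
contains few patterns of `Q`, as otherwise patterns in `Q` would be seen too often; hence it has
volume at most about `exp (-m)`. Gibbs' inequality converts the average entropy of the containers
into the lower bound `(m / |V N| - o(1)) * |V n|` on `-log vol (P n)`.
-/

section Finner

open scoped ENNReal

variable {ι δ : Type*} [DecidableEq δ] {X : δ → Type*} [∀ i, MeasurableSpace (X i)]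
  {μ : ∀ i, Measure (X i)}

theorem dependsOn_lmarginal {f : (∀ i, X i) → ℝ≥0∞} {S : Set δ} (hf : DependsOn f S)
    (s : Finset δ) : DependsOn (∫⋯∫⁻_s, f ∂μ) (S \ s) := fun _ _ h =>
  lintegral_congr fun y => hf.updateFinset y h

variable [∀ i, IsProbabilityMeasure (μ i)]

theorem lmarginal_prod_rpow_le (E : Finset ι) {S : ι → Finset δ} {f : ι → (∀ i, X i) → ℝ≥0∞}
    (hf : ∀ e, Measurable (f e)) (hfS : ∀ e, DependsOn (f e) (S e)) {p : ι → ℝ}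
    (hp : ∀ e, 0 ≤ p e) (hcover : ∀ v, ∑ e ∈ E with v ∈ S e, p e = 1) (s : Finset δ)
    (x : ∀ i, X i) :
    (∫⋯∫⁻_s, (fun x => ∏ e ∈ E, f e x ^ p e) ∂μ) x ≤ ∏ e ∈ E, (∫⋯∫⁻_s, f e ∂μ) x ^ p e := by
  have hmeas : Measurable fun x => ∏ e ∈ E, f e x ^ p e :=
    Finset.measurable_prod _ fun e _ => (hf e).pow_const _
  induction s using Finset.induction generalizing x with
  | empty => simp
  | insert v s hv ih =>
    let g : ι → X v → ℝ≥0∞ := fun e t => (∫⋯∫⁻_s, f e ∂μ) (Function.update x v t)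
    have hg : ∀ e, Measurable (g e) := fun e => ((hf e).lmarginal μ).comp (measurable_update x)
    have hint : ∀ e, (∫⋯∫⁻_insert v s, f e ∂μ) x = ∫⁻ t, g e t ∂μ v := fun e =>
      lmarginal_insert _ (hf e) hv x
    have hconst : ∀ e, v ∉ S e → ∀ t, g e t = (∫⋯∫⁻_s, f e ∂μ) x := fun e he t =>
      dependsOn_lmarginal (hfS e) s fun w hw =>
        Function.update_of_ne (fun h : w = v => he (h ▸ hw.1)) _ _
    have hsplit := fun F : ι → ℝ≥0∞ =>
      (Finset.prod_filter_mul_prod_filter_not E (fun e => v ∈ S e) F).symm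
    calc (∫⋯∫⁻_insert v s, (fun x => ∏ e ∈ E, f e x ^ p e) ∂μ) x
        ≤ ∫⁻ t, ∏ e ∈ E, g e t ^ p e ∂μ v := by
          rw [lmarginal_insert _ hmeas hv]
          exact lintegral_mono fun t => ih _
      _ = ∫⁻ t, (∏ e ∈ E with v ∈ S e, g e t ^ p e) *
            ∏ e ∈ E with v ∉ S e, (∫⋯∫⁻_s, f e ∂μ) x ^ p e ∂μ v := by
          refine lintegral_congr fun t => ?_
          rw [hsplit]
          refine congrArg _ (Finset.prod_congr rfl fun e he => ?_)
          rw [hconst e (Finset.mem_filter.1 he).2]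
      _ = (∫⁻ t, ∏ e ∈ E with v ∈ S e, g e t ^ p e ∂μ v) *
            ∏ e ∈ E with v ∉ S e, (∫⋯∫⁻_s, f e ∂μ) x ^ p e :=
          lintegral_mul_const _ (Finset.measurable_prod _ fun e _ => (hg e).pow_const _)
      _ ≤ (∏ e ∈ E with v ∈ S e, (∫⁻ t, g e t ∂μ v) ^ p e) *
            ∏ e ∈ E with v ∉ S e, (∫⋯∫⁻_s, f e ∂μ) x ^ p e := by
          gcongr
          exact ENNReal.lintegral_prod_norm_pow_le _ (fun e _ => (hg e).aemeasurable)
            (hcover v) fun e _ => hp e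
      _ = ∏ e ∈ E, (∫⋯∫⁻_insert v s, f e ∂μ) x ^ p e := by
          simp only [hint]
          rw [hsplit]
          refine congrArg _ (Finset.prod_congr rfl fun e he => ?_)
          simp [hconst e (Finset.mem_filter.1 he).2]

/-- Finner's inequality: Hölder's inequality is applied to one coordinate after the other. -/
theorem lintegral_prod_rpow_le_of_cover [Fintype δ] (E : Finset ι) {S : ι → Finset δ}
    {f : ι → (∀ i, X i) → ℝ≥0∞} (hf : ∀ e, Measurable (f e))
    (hfS : ∀ e, DependsOn (f e) (S e)) {p : ι → ℝ} (hp : ∀ e, 0 ≤ p e)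
    (hcover : ∀ v, ∑ e ∈ E with v ∈ S e, p e = 1) :
    ∫⁻ x, ∏ e ∈ E, f e x ^ p e ∂Measure.pi μ ≤ ∏ e ∈ E, (∫⁻ x, f e x ∂Measure.pi μ) ^ p e := by
  have (i : δ) : Nonempty (X i) := nonempty_of_isProbabilityMeasure (μ i)
  simpa using lmarginal_prod_rpow_le (μ := μ) E hf hfS hp hcover Finset.univ
    fun i => Classical.arbitrary (X i)

end Finner

section SetwiseLimit

open scoped ENNReal

variable {α Ω : Type*} [MeasurableSpace Ω] {m : Measure Ω} [IsFiniteMeasure m]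
  {ν : α → Measure Ω}

/-- Domination by `m` is what makes the setwise limit countably additive: it allows to exchange the
limit with the sum over the pieces. -/
theorem iUnion_eq_tsum_of_tendsto_of_le (hν : ∀ a, ν a ≤ m) {l : Filter α} [l.NeBot]
    {r : Set Ω → ℝ≥0∞} (hr : ∀ s, Tendsto (fun a => ν a s) l (𝓝 (r s))) {s : ℕ → Set Ω}
    (hs : ∀ i, MeasurableSet (s i)) (hdisj : Pairwise (Function.onFun Disjoint s)) :
    r (⋃ i, s i) = ∑' i, r (s i) := by
  have hmν : ∀ a t, ν a t ≠ ∞ := fun a t => ((hν a t).trans_lt (measure_lt_top m t)).ne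
  have hrm : ∀ t, r t ≤ m t := fun t => le_of_tendsto (hr t) (.of_forall fun a => hν a t)
  have hr_ne : ∀ t, r t ≠ ∞ := fun t => ((hrm t).trans_lt (measure_lt_top m t)).ne
  have hm_sum : ∑' i, m (s i) ≠ ∞ := measure_iUnion hdisj hs ▸ measure_ne_top m _
  have hr_real : ∀ t, Tendsto (fun a => (ν a t).toReal) l (𝓝 (r t).toReal) := fun t =>
    (ENNReal.tendsto_toReal (hr_ne t)).comp (hr t)
  have hsum : Tendsto (fun a => ∑' i, (ν a (s i)).toReal) l (𝓝 (∑' i, (r (s i)).toReal)) := by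
    refine tendsto_tsum_of_dominated_convergence (ENNReal.summable_toReal hm_sum)
      (fun i => hr_real (s i)) (.of_forall fun a i => ?_)
    rw [Real.norm_of_nonneg ENNReal.toReal_nonneg]
    exact ENNReal.toReal_mono (measure_ne_top m _) (hν a _)
  have hadd : ∀ a, (ν a (⋃ i, s i)).toReal = ∑' i, (ν a (s i)).toReal := fun a => by
    rw [measure_iUnion hdisj hs, ENNReal.tsum_toReal_eq fun i => hmν a _]
  have hlim := tendsto_nhds_unique (hr_real (⋃ i, s i)) (by simpa only [hadd] using hsum)
  rw [← ENNReal.tsum_toReal_eq fun i => hr_ne _] at hlim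
  refine (ENNReal.toReal_eq_toReal_iff' (hr_ne _) ?_).1 hlim
  exact ((ENNReal.tsum_le_tsum fun i => hrm (s i)).trans_lt hm_sum.lt_top).ne

theorem exists_measure_tendsto_ultrafilter (hν : ∀ a, ν a ≤ m) (U : Ultrafilter α) :
    ∃ ρ ≤ m, ∀ s, MeasurableSet s → Tendsto (fun a => ν a s) U (𝓝 (ρ s)) := by
  choose r hr using fun s : Set Ω =>
    (⟨_, (U.map fun a => ν a s).le_nhds_lim⟩ : ∃ b, Tendsto (fun a => ν a s) U (𝓝 b))
  have hr_empty : r ∅ = 0 := tendsto_nhds_unique (hr ∅) (by simp)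
  let ρ : Measure Ω := Measure.ofMeasurable (fun s _ => r s) hr_empty
    fun _ hs hdisj => iUnion_eq_tsum_of_tendsto_of_le hν hr hs hdisj
  have hρ : ∀ s, MeasurableSet s → ρ s = r s := fun s hs => Measure.ofMeasurable_apply s hs
  refine ⟨ρ, Measure.le_iff.2 fun s hs => ?_, fun s hs => hρ s hs ▸ hr s⟩
  exact (hρ s hs).trans_le (le_of_tendsto (hr s) (.of_forall fun a => hν a s))

end SetwiseLimit

section AlmostContainedBoxes

open scoped ENNReal

variable {ι : Type*} [Fintype ι] {X : ι → Type*} [∀ i, MeasurableSpace (X i)]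
  {μ : ∀ i, Measure (X i)}

theorem pi_withDensity [∀ i, IsProbabilityMeasure (μ i)] {w : ∀ i, X i → ℝ≥0∞}
    (hw : ∀ i, Measurable (w i)) [∀ i, SigmaFinite ((μ i).withDensity (w i))] :
    Measure.pi (fun i => (μ i).withDensity (w i)) =
      (Measure.pi μ).withDensity fun x => ∏ i, w i (x i) := by
  refine Measure.pi_eq fun s hs => ?_
  have hind : (Set.univ.pi s).indicator (fun x => ∏ i, w i (x i)) =
      fun x => ∏ i, (s i).indicator (w i) (x i) := by
    classical
    ext x
    simp only [Set.indicator_apply, Set.mem_univ_pi, Finset.prod_ite_zero, Finset.mem_univ,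
      forall_const]
  have hm : ∀ i, Measurable ((s i).indicator (w i)) := fun i => (hw i).indicator (hs i)
  rw [withDensity_apply _ (.univ_pi hs), ← lintegral_indicator (.univ_pi hs), hind,
    ProbabilityTheory.lintegral_prod_eq_prod_lintegral_of_indepFun Finset.univ _
      (ProbabilityTheory.iIndepFun_pi fun i => (hm i).aemeasurable)
      fun i => (hm i).comp (measurable_pi_apply i)]
  refine Finset.prod_congr rfl fun i _ => ?_
  rw [withDensity_apply _ (hs i), ← lintegral_indicator (hs i)]
  exact (measurePreserving_eval μ i).lintegral_comp (hm i)

theorem pi_eq_of_tendsto_restrict_pi [∀ i, IsFiniteMeasure (μ i)] {α : Type*} {l : Filter α}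
    [l.NeBot] {A : α → ∀ i, Set (X i)} {ρ : ∀ i, Measure (X i)} [∀ i, IsFiniteMeasure (ρ i)]
    (hρ : ∀ i s, MeasurableSet s → Tendsto (fun a => (μ i).restrict (A a i) s) l (𝓝 (ρ i s)))
    {σ : Measure (∀ i, X i)} (hσ : ∀ s, MeasurableSet s →
      Tendsto (fun a => (Measure.pi μ).restrict (Set.univ.pi (A a)) s) l (𝓝 (σ s))) :
    Measure.pi ρ = σ := by
  refine Measure.pi_eq fun s hs => tendsto_nhds_unique (hσ _ (.univ_pi hs)) ?_
  simp only [Measure.restrict_pi_pi, Measure.pi_pi]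
  exact ENNReal.tendsto_finsetProd_of_ne_top _ (fun i _ => hρ i _ (hs i))
    fun i _ => measure_ne_top _ _

/-- The sides of the box are the supports of the densities of the `ρ i`. -/
theorem exists_box_of_pi_le [∀ i, IsProbabilityMeasure (μ i)] {ρ : ∀ i, Measure (X i)}
    (hρμ : ∀ i, ρ i ≤ μ i) {N : Set (∀ i, X i)} (hN : Measure.pi ρ N = 0) :
    ∃ D : ∀ i, Set (X i), (∀ i, MeasurableSet (D i)) ∧ Measure.pi μ (Set.univ.pi D ∩ N) = 0 ∧
      Measure.pi ρ Set.univ ≤ Measure.pi μ (Set.univ.pi D) := by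
  have (i : ι) : IsFiniteMeasure (ρ i) := isFiniteMeasure_of_le (μ i) (hρμ i)
  let w : ∀ i, X i → ℝ≥0∞ := fun i => (ρ i).rnDeriv (μ i)
  have hw : ∀ i, Measurable (w i) := fun i => Measure.measurable_rnDeriv _ _
  have hρw : ∀ i, (μ i).withDensity (w i) = ρ i := fun i =>
    Measure.withDensity_rnDeriv_eq _ _ (Measure.absolutelyContinuous_of_le (hρμ i))
  have (i : ι) : SigmaFinite ((μ i).withDensity (w i)) := by rw [hρw]; infer_instance
  refine ⟨fun i => {x | w i x ≠ 0}, fun i => (hw i (measurableSet_singleton 0)).compl, ?_, ?_⟩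
  · have hprod : Measurable fun x : ∀ i, X i => ∏ i, w i (x i) :=
      Finset.measurable_prod _ fun i _ => (hw i).comp (measurable_pi_apply i)
    rw [← funext hρw, pi_withDensity hw, withDensity_apply_eq_zero hprod] at hN
    refine measure_mono_null (Set.inter_subset_inter_left N fun x hx => ?_) hN
    exact Finset.prod_ne_zero_iff.2 fun i _ => hx i (Set.mem_univ i)
  · have hsupp : ∀ i, ρ i {x | w i x ≠ 0}ᶜ = 0 := fun i => by
      rw [← hρw i, withDensity_apply_eq_zero (hw i), Set.inter_compl_self, measure_empty]
    rw [← Set.pi_univ Set.univ, Measure.pi_pi, Measure.pi_pi]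
    refine Finset.prod_le_prod' fun i _ => ?_
    refine (measure_mono_ae (ae_le_set.2 ?_)).trans (hρμ i _)
    rw [← Set.compl_eq_univ_sdiff, hsupp i]

/-- Otherwise boxes `A j` of measure at least `t` with `A j \ P` of measure tending to zero would
have a limiting box that is almost contained in `P`. -/
theorem exists_pos_forall_box_lt [∀ i, IsProbabilityMeasure (μ i)] {P : Set (∀ i, X i)}
    (hP : NullMeasurableSet P (Measure.pi μ)) {t : ℝ≥0∞}
    (h : ∀ A : ∀ i, Set (X i), (∀ i, MeasurableSet (A i)) →
      Measure.pi μ (Set.univ.pi A \ P) = 0 → Measure.pi μ (Set.univ.pi A) < t) :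
    ∃ κ : ℝ, 0 < κ ∧ ∀ A : ∀ i, Set (X i),
      Measure.pi μ (Set.univ.pi A \ P) ≤ ENNReal.ofReal κ → Measure.pi μ (Set.univ.pi A) < t := by
  by_contra! hcon
  choose A hAP hAt using fun j : ℕ => hcon (1 / (j + 1)) (by positivity)
  obtain ⟨B, hPB, hB, hBP⟩ := hP.exists_measurable_superset_ae_eq
  let U : Ultrafilter ℕ := hyperfilter ℕ
  choose ρ hρμ hρ using fun i => exists_measure_tendsto_ultrafilter
    (ν := fun j => (μ i).restrict (A j i)) (fun _ => Measure.restrict_le_self) U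
  have (i : ι) : IsFiniteMeasure (ρ i) := isFiniteMeasure_of_le (μ i) (hρμ i)
  obtain ⟨σ, -, hσ⟩ := exists_measure_tendsto_ultrafilter
    (ν := fun j => (Measure.pi μ).restrict (Set.univ.pi (A j))) (fun _ => Measure.restrict_le_self)
    U
  obtain rfl := pi_eq_of_tendsto_restrict_pi hρ hσ
  have hBc : Measure.pi ρ Bᶜ = 0 := by
    have hzero : Tendsto (fun j : ℕ => ENNReal.ofReal (1 / (j + 1))) U (𝓝 0) := by
      simpa using (ENNReal.tendsto_ofReal
        (tendsto_one_div_add_atTop_nhds_zero_nat (𝕜 := ℝ))).mono_left Nat.hyperfilter_le_atTop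
    refine le_antisymm (le_of_tendsto_of_tendsto (hσ _ hB.compl) hzero (.of_forall fun j => ?_))
      bot_le
    simp only [Measure.restrict_apply hB.compl, Set.inter_comm]
    exact (measure_mono (Set.sdiff_subset_sdiff_right hPB)).trans (hAP j)
  obtain ⟨D, hD, hDB, hρD⟩ := exists_box_of_pi_le hρμ hBc
  have hDP : Measure.pi μ (Set.univ.pi D \ P) = 0 :=
    (measure_congr ((ae_eq_refl (Set.univ.pi D)).diff hBP)).symm.trans hDB
  refine ((h D hD hDP).trans_le ?_).not_ge hρD
  exact ge_of_tendsto (hσ _ .univ) (.of_forall fun j => by simpa using hAt j)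

end AlmostContainedBoxes

section ColourDetermined

open scoped ENNReal symmDiff

variable {ι X : Type*}

/-- The sets of points `x` of a power `ι → X` that are determined by the pattern `q ∘ x` of colours
of the coordinates of `x`, for some measurable colouring `q` of `X` with finitely many colours. -/
def colourDetermined (ι X : Type*) [MeasurableSpace X] : Set (Set (ι → X)) :=
  {T | ∃ (K : Type) (_ : Fintype K) (q : X → K) (Q : Set (ι → K)),
    (∀ a, MeasurableSet (q ⁻¹' {a})) ∧ T = {x | q ∘ x ∈ Q}}

variable [MeasurableSpace X]

/-- The two colourings are combined into one with values in the product of the sets of colours. -/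
theorem colourDetermined_setOf_op (op : Prop → Prop → Prop) {s t : Set (ι → X)}
    (hs : s ∈ colourDetermined ι X) (ht : t ∈ colourDetermined ι X) :
    {x | op (x ∈ s) (x ∈ t)} ∈ colourDetermined ι X := by
  obtain ⟨K, _, q, Q, hq, rfl⟩ := hs
  obtain ⟨K', _, q', Q', hq', rfl⟩ := ht
  refine ⟨K × K', inferInstance, fun x => (q x, q' x),
    {y | op (Prod.fst ∘ y ∈ Q) (Prod.snd ∘ y ∈ Q')}, fun a => ?_, rfl⟩
  convert (hq a.1).inter (hq' a.2) using 1
  ext x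
  simp [Prod.ext_iff]

theorem empty_mem_colourDetermined : ∅ ∈ colourDetermined ι X :=
  ⟨Unit, inferInstance, fun _ => (), ∅, fun a => by simp, by simp⟩

theorem univ_mem_colourDetermined : Set.univ ∈ colourDetermined ι X :=
  ⟨Unit, inferInstance, fun _ => (), Set.univ, fun a => by simp, by simp⟩

theorem isSetRing_colourDetermined : IsSetRing (colourDetermined ι X) where
  empty_mem := empty_mem_colourDetermined
  union_mem _ _ hs ht := colourDetermined_setOf_op Or hs ht
  sdiff_mem _ _ hs ht := colourDetermined_setOf_op (fun a b => a ∧ ¬b) hs ht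

variable [Finite ι]

theorem measurableSet_setOf_comp_mem {K : Type*} [Finite K] {q : X → K}
    (hq : ∀ a, MeasurableSet (q ⁻¹' {a})) (Q : Set (ι → K)) :
    MeasurableSet {x : ι → X | q ∘ x ∈ Q} := by
  have hfibre : ∀ y : ι → K, MeasurableSet {x : ι → X | q ∘ x = y} := fun y => by
    convert MeasurableSet.iInter fun i => measurable_pi_apply i (hq (y i)) using 1
    ext x
    simp [funext_iff]
  convert MeasurableSet.biUnion Q.to_countable fun y _ => hfibre y using 1
  ext x
  simp

theorem generateFrom_colourDetermined :
    MeasurableSpace.generateFrom (colourDetermined ι X) = MeasurableSpace.pi := by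
  refine le_antisymm (MeasurableSpace.generateFrom_le ?_) (iSup_le fun i => ?_)
  · rintro _ ⟨K, _, q, Q, hq, rfl⟩
    exact measurableSet_setOf_comp_mem hq Q
  · rintro _ ⟨s, hs, rfl⟩
    exact MeasurableSpace.measurableSet_generateFrom ⟨Prop, inferInstance, fun x => x ∈ s,
      {y | y i}, fun a => hs.mem (measurableSet_singleton a), rfl⟩

theorem exists_colouring_measure_symmDiff_lt (m : Measure (ι → X)) [IsFiniteMeasure m]
    {P : Set (ι → X)} (hP : NullMeasurableSet P m) {ε : ℝ≥0∞} (hε : 0 < ε) :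
    ∃ (K : Type) (_ : Fintype K) (q : X → K) (Q : Set (ι → K)),
      (∀ a, MeasurableSet (q ⁻¹' {a})) ∧ m ({x | q ∘ x ∈ Q} ∆ P) < ε := by
  obtain ⟨B, hB, hPB⟩ := hP
  obtain ⟨_, ⟨K, _, q, Q, hq, rfl⟩, hQ⟩ :=
    exists_measure_symmDiff_lt_of_generateFrom_isSetRing (μ := m) isSetRing_colourDetermined
      ⟨{Set.univ}, by simp, by simpa using univ_mem_colourDetermined, by simp⟩
      generateFrom_colourDetermined.symm hB hε
  refine ⟨K, inferInstance, q, Q, hq, ?_⟩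
  rwa [measure_congr ((ae_eq_refl _).symmDiff hPB)]

end ColourDetermined

section Pinning

open Finset

section RandomSubset

variable {V : Type*} [Fintype V] [DecidableEq V]

/-- The probability that a random subset of `V`, which contains each element independently with
probability `q`, is equal to `R`. -/
def bernoulliWeight (q : ℝ) (R : Finset V) : ℝ := q ^ #R * (1 - q) ^ #Rᶜ

theorem bernoulliWeight_nonneg {q : ℝ} (hq : q ∈ Set.Icc 0 1) (R : Finset V) :
    0 ≤ bernoulliWeight q R :=
  mul_nonneg (pow_nonneg hq.1 _) (pow_nonneg (sub_nonneg.2 hq.2) _)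

theorem sum_bernoulliWeight_superset (q : ℝ) (S : Finset V) :
    ∑ R with S ⊆ R, bernoulliWeight q R = q ^ #S := by
  have hprod : ∀ R : Finset V, q ^ #R * ∏ v ∈ univ \ R, (if v ∈ S then 0 else 1 - q) =
      if S ⊆ R then bernoulliWeight q R else 0 := fun R => by
    split_ifs with hSR
    · rw [bernoulliWeight, ← compl_eq_univ_sdiff, ← prod_const (1 - q)]
      refine congrArg _ (prod_congr rfl fun v hv => if_neg fun hvS => ?_)
      exact mem_compl.1 hv (hSR hvS)
    · obtain ⟨v, hvS, hvR⟩ := not_subset.1 hSR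
      exact mul_eq_zero_of_right _ (prod_eq_zero (i := v) (by simpa using hvR) (if_pos hvS))
  have hexpand := prod_add (fun _ => q) (fun v => if v ∈ S then 0 else 1 - q) univ
  simp only [powerset_univ, prod_const, hprod, ← sum_filter] at hexpand
  rw [← hexpand, ← prod_const, ← prod_subset (subset_univ S) fun v _ hv => by simp [hv]]
  exact prod_congr rfl fun v hv => by simp [hv]

theorem sum_bernoulliWeight_mul_card (q : ℝ) :
    ∑ R : Finset V, bernoulliWeight q R * #R = q * Fintype.card V := by
  calc ∑ R : Finset V, bernoulliWeight q R * #R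
      = ∑ v : V, ∑ R with {v} ⊆ R, bernoulliWeight q R := by
        simp only [sum_filter]
        rw [sum_comm]
        refine sum_congr rfl fun R _ => ?_
        simp [mul_comm]
    _ = q * Fintype.card V := by
        simp only [sum_bernoulliWeight_superset]
        simp [mul_comm]

variable {α : Type*}

theorem sum_bernoulliWeight_mul_sum_sq_card (q : ℝ) (I : Finset α) (root : α → V)
    (T : α → Finset V) :
    ∑ R, bernoulliWeight q R * ∑ v, (#{a ∈ I | root a = v ∧ T a ⊆ R} : ℝ) ^ 2 =
      ∑ p ∈ I ×ˢ I with root p.1 = root p.2, q ^ #(T p.1 ∪ T p.2) := by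
  have hsq : ∀ R, ∑ v, (#{a ∈ I | root a = v ∧ T a ⊆ R} : ℝ) ^ 2 =
      ∑ p ∈ I ×ˢ I with root p.1 = root p.2, if T p.1 ∪ T p.2 ⊆ R then 1 else 0 := fun R => by
    have hpairs : ∀ v, #{a ∈ I | root a = v ∧ T a ⊆ R} ^ 2 =
        #{p ∈ {p ∈ I ×ˢ I | root p.1 = root p.2 ∧ T p.1 ∪ T p.2 ⊆ R} | root p.1 = v} := fun v => by
      rw [sq, ← card_product]
      congr 1
      ext p
      simp only [mem_product, mem_filter, union_subset_iff]
      grind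
    rw [sum_boole, filter_filter, card_eq_sum_card_fiberwise (t := univ) (f := fun p => root p.1)
      fun _ _ => mem_univ _]
    push_cast [← hpairs]
    rfl
  simp only [hsq, mul_sum]
  rw [sum_comm]
  refine sum_congr rfl fun p _ => ?_
  simp only [mul_ite, mul_one, mul_zero, ← sum_filter, sum_bernoulliWeight_superset]

/-- The set `T a` is contained in the random set `R` with probability `q ^ #(T a)`. -/
theorem sum_pow_mul_le_sum_bernoulliWeight (I : Finset α) (root : α → V) (T : α → Finset V)
    {h : V → Finset V → ℝ} (hmono : ∀ v, Monotone (h v)) {q : ℝ} (hq : q ∈ Set.Icc 0 1) :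
    ∑ a ∈ I, q ^ #(T a) * h (root a) (T a) ≤
      ∑ R, ∑ v, bernoulliWeight q R * (h v R * #{a ∈ I | root a = v ∧ T a ⊆ R}) := by
  have hcount : ∀ R, ∑ v, h v R * #{a ∈ I | root a = v ∧ T a ⊆ R} =
      ∑ a ∈ I with T a ⊆ R, h (root a) R := fun R => by
    rw [← sum_fiberwise _ root]
    refine sum_congr rfl fun v _ => ?_
    rw [filter_filter, sum_congr rfl fun a ha => by rw [(mem_filter.1 ha).2.2]]
    simp only [sum_const, nsmul_eq_mul, mul_comm, and_comm]
  simp only [← mul_sum, hcount]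
  simp only [mul_sum, sum_filter]
  rw [sum_comm]
  refine sum_le_sum fun a _ => ?_
  rw [← sum_bernoulliWeight_superset, sum_mul, sum_filter]
  refine sum_le_sum fun R _ => ?_
  split_ifs with hR
  · exact mul_le_mul_of_nonneg_left (hmono _ hR) (bernoulliWeight_nonneg hq R)
  · simp

theorem sum_bernoulliWeight_mul_sq_le {h : V → Finset V → ℝ} (hh : ∀ v R, h v R ∈ Set.Icc 0 1)
    {q C : ℝ} (hq : q ∈ Set.Icc 0 1) (hsum : ∀ R : Finset V, ∑ v, h v R ≤ C * #R) :
    ∑ R, ∑ v, bernoulliWeight q R * h v R ^ 2 ≤ C * q * Fintype.card V := by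
  calc ∑ R, ∑ v, bernoulliWeight q R * h v R ^ 2
      ≤ ∑ R : Finset V, bernoulliWeight q R * (C * #R) := by
        refine sum_le_sum fun R _ => ?_
        rw [← mul_sum]
        refine mul_le_mul_of_nonneg_left (le_trans ?_ (hsum R)) (bernoulliWeight_nonneg hq R)
        exact sum_le_sum fun v _ => pow_le_of_le_one (hh v R).1 (hh v R).2 two_ne_zero
    _ = C * q * Fintype.card V := by
        simp only [mul_left_comm _ C, ← mul_sum, sum_bernoulliWeight_mul_card, mul_assoc]

theorem sq_sum_pow_mul_le (I : Finset α) (root : α → V) (T : α → Finset V)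
    {h : V → Finset V → ℝ} (hh : ∀ v R, h v R ∈ Set.Icc 0 1) (hmono : ∀ v, Monotone (h v))
    {q C : ℝ} (hq : q ∈ Set.Icc 0 1) (hsum : ∀ R : Finset V, ∑ v, h v R ≤ C * #R) :
    (∑ a ∈ I, q ^ #(T a) * h (root a) (T a)) ^ 2 ≤
      C * q * Fintype.card V *
        ∑ p ∈ I ×ˢ I with root p.1 = root p.2, q ^ #(T p.1 ∪ T p.2) := by
  let count : Finset V → V → ℝ := fun R v => #{a ∈ I | root a = v ∧ T a ⊆ R}
  have hw := fun R : Finset V => bernoulliWeight_nonneg hq R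
  have hpos : 0 ≤ ∑ a ∈ I, q ^ #(T a) * h (root a) (T a) :=
    sum_nonneg fun a _ => mul_nonneg (pow_nonneg hq.1 _) (hh _ _).1
  calc (∑ a ∈ I, q ^ #(T a) * h (root a) (T a)) ^ 2
      ≤ (∑ R, ∑ v, bernoulliWeight q R * (h v R * count R v)) ^ 2 :=
        pow_le_pow_left₀ hpos (sum_pow_mul_le_sum_bernoulliWeight I root T hmono hq) 2
    _ ≤ (∑ R, ∑ v, bernoulliWeight q R * h v R ^ 2) *
          ∑ R, ∑ v, bernoulliWeight q R * count R v ^ 2 := by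
        simp only [← Fintype.sum_prod_type']
        exact sum_sq_le_sum_mul_sum_of_sq_le_mul univ
          (fun x _ => mul_nonneg (hw x.1) (sq_nonneg _))
          (fun x _ => mul_nonneg (hw x.1) (sq_nonneg _)) fun x _ => (by ring : _ = _).le
    _ ≤ C * q * Fintype.card V *
          ∑ p ∈ I ×ˢ I with root p.1 = root p.2, q ^ #(T p.1 ∪ T p.2) := by
        have hsecond := sum_bernoulliWeight_mul_sum_sq_card q I root T
        simp only [mul_sum (univ : Finset V)] at hsecond
        rw [hsecond]
        exact mul_le_mul_of_nonneg_right (sum_bernoulliWeight_mul_sq_le hh hq hsum)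
          (sum_nonneg fun p _ => pow_nonneg hq.1 _)

/-- Energy increment: `F` maximises `∑ v, g v F - C * #F`, so pinning further elements increases
`g` by at most `C` per element. -/
theorem exists_pinning_set_of_rooted (I : Finset α) (root : α → V) (T : α → Finset V)
    {g : V → Finset V → ℝ} (hg : ∀ v F, g v F ∈ Set.Icc 0 1) (hmono : ∀ v, Monotone (g v))
    {q C : ℝ} (hq : q ∈ Set.Icc 0 1) (hC : 0 ≤ C) :
    ∃ F : Finset V, C * #F ≤ Fintype.card V ∧
      (∑ a ∈ I, q ^ #(T a) * (g (root a) (F ∪ T a) - g (root a) F)) ^ 2 ≤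
        C * q * Fintype.card V *
          ∑ p ∈ I ×ˢ I with root p.1 = root p.2, q ^ #(T p.1 ∪ T p.2) := by
  obtain ⟨F, -, hF⟩ := exists_max_image univ (fun F : Finset V => ∑ v, g v F - C * #F)
    univ_nonempty
  refine ⟨F, ?_, sq_sum_pow_mul_le I root T (h := fun v R => g v (F ∪ R) - g v F)
    (fun v R => ⟨?_, ?_⟩) (fun v R R' hR => ?_) hq fun R => ?_⟩
  · have hempty := hF ∅ (mem_univ _)
    have h0 : 0 ≤ ∑ v, g v ∅ := sum_nonneg fun v _ => (hg v ∅).1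
    have h1 : ∑ v, g v F ≤ Fintype.card V := by
      simpa using sum_le_card_nsmul univ (fun v => g v F) 1 fun v _ => (hg v F).2
    simp only [card_empty, Nat.cast_zero, mul_zero] at hempty
    linarith
  · exact sub_nonneg.2 (hmono v subset_union_left)
  · linarith [(hg v (F ∪ R)).2, (hg v F).1]
  · exact sub_le_sub_right (hmono v (union_subset_union_right hR)) _
  · have hmax := hF (F ∪ R) (mem_univ _)
    have hcard : (#(F ∪ R) : ℝ) ≤ #F + #R := mod_cast card_union_le F R
    rw [sum_sub_distrib]
    nlinarith

end RandomSubset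

variable {U V : Type*} [Fintype U]

/-- The image of `φ` without the point `φ i`. -/
def link [DecidableEq U] (φ : U ↪ V) (i : U) : Finset V := (univ.erase i).map φ

theorem card_link [DecidableEq U] (φ : U ↪ V) (i : U) : #(link φ i) = Fintype.card U - 1 := by
  simp [link]

variable [DecidableEq V]

/-- Each element of `V` lies in the image of exactly `k` of the embeddings in `E`. -/
def IsRegularFamily (E : Finset (U ↪ V)) (k : ℕ) : Prop :=
  ∀ v, #{φ ∈ E | v ∈ univ.map φ} = k

/-- The pairs of embeddings in `E` whose images share more than one and fewer than `|U|`
elements. -/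
def partialOverlaps (E : Finset (U ↪ V)) : Finset ((U ↪ V) × (U ↪ V)) :=
  {p ∈ E ×ˢ E | 1 < #(univ.map p.1 ∩ univ.map p.2) ∧
    #(univ.map p.1 ∩ univ.map p.2) < Fintype.card U}

/-- The pairs of an embedding `φ ∈ E` and an element `i` of `U`, as a way to index the
occurrences `φ i` of elements of `V` in the images of the embeddings. -/
def incidences (E : Finset (U ↪ V)) : Finset ((U ↪ V) × U) := E ×ˢ univ

namespace IsRegularFamily

variable {E : Finset (U ↪ V)} {k : ℕ}

theorem card_incidences_eq (hE : IsRegularFamily E k) (v : V) :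
    #{a ∈ incidences E | a.1 a.2 = v} = k := by
  rw [← hE v]
  refine card_bij (fun a _ => a.1) (fun a ha => ?_) (fun a ha b hb hab => ?_) fun φ hφ => ?_
  · simp only [incidences, mem_filter, mem_product, mem_univ, and_true] at ha
    simpa [ha.1] using ⟨a.2, ha.2⟩
  · refine Prod.ext hab (a.1.injective ?_)
    rw [(mem_filter.1 ha).2, hab, (mem_filter.1 hb).2]
  · obtain ⟨hφE, i, -, hi⟩ := by simpa only [mem_filter, Finset.mem_map] using hφ
    exact ⟨(φ, i), by simpa [incidences, hφE] using hi, rfl⟩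

variable [Fintype V]

theorem sum_sum_apply_eq (hE : IsRegularFamily E k) {M : Type*} [AddCommMonoid M] (s : V → M) :
    ∑ φ ∈ E, ∑ i, s (φ i) = k • ∑ v, s v := by
  rw [← sum_product' E univ fun φ i => s (φ i), ← sum_fiberwise _ fun a => a.1 a.2, smul_sum]
  refine sum_congr rfl fun v _ => ?_
  rw [sum_congr rfl fun a ha => by rw [(mem_filter.1 ha).2], sum_const]
  exact congrArg (· • s v) (hE.card_incidences_eq v)

theorem card_mul_card_eq (hE : IsRegularFamily E k) :
    Fintype.card U * #E = k * Fintype.card V := by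
  simpa [mul_comm] using hE.sum_sum_apply_eq fun _ => (1 : ℕ)

theorem card_incidence_pairs_eq (hE : IsRegularFamily E k) :
    #{p ∈ incidences E ×ˢ incidences E | p.1.1 p.1.2 = p.2.1 p.2.2} =
      k ^ 2 * Fintype.card V := by
  rw [card_eq_sum_card_fiberwise (t := univ) (f := fun p => p.1.1 p.1.2) fun _ _ => mem_univ _]
  have hfibre : ∀ v, #{p ∈ {p ∈ incidences E ×ˢ incidences E | p.1.1 p.1.2 = p.2.1 p.2.2} |
      p.1.1 p.1.2 = v} = k ^ 2 := fun v => by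
    rw [sq, ← hE.card_incidences_eq v, ← card_product]
    congr 1
    ext p
    simp only [mem_product, mem_filter]
    grind
  simp [hfibre, mul_comm]

end IsRegularFamily

theorem card_filter_map_inter_map_eq_le (E : Finset (U ↪ V)) (φ : U ↪ V) :
    #{ψ ∈ E | Fintype.card U ≤ #(univ.map φ ∩ univ.map ψ)} ≤
      Fintype.card U ^ Fintype.card U := by
  classical
  have hmem : ∀ ψ ∈ {ψ ∈ E | Fintype.card U ≤ #(univ.map φ ∩ univ.map ψ)}, ∀ i,
      ∃ j, φ j = ψ i := fun ψ hψ i => by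
    have himage : univ.map φ ∩ univ.map ψ = univ.map ψ :=
      eq_of_subset_of_card_le inter_subset_right (by simpa using (mem_filter.1 hψ).2)
    have hi : ψ i ∈ univ.map φ ∩ univ.map ψ :=
      himage.symm ▸ mem_map_of_mem ψ (mem_univ i)
    simpa using (mem_inter.1 hi).1
  choose! f hf using hmem
  rw [← Fintype.card_fun, ← card_univ]
  refine card_le_card_of_injOn f (fun _ _ => mem_univ _) fun ψ hψ ψ' hψ' hff' => ?_
  ext i
  rw [← hf ψ hψ, ← hf ψ' hψ', hff']

theorem card_filter_one_lt_overlap_le (E : Finset (U ↪ V)) :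
    #{p ∈ E ×ˢ E | 1 < #(univ.map p.1 ∩ univ.map p.2)} ≤
      #(partialOverlaps E) + #E * Fintype.card U ^ Fintype.card U := by
  have hfull : #{p ∈ E ×ˢ E | Fintype.card U ≤ #(univ.map p.1 ∩ univ.map p.2)} ≤
      #E * Fintype.card U ^ Fintype.card U := by
    rw [card_filter, sum_product, ← smul_eq_mul]
    refine sum_le_card_nsmul _ _ _ fun φ _ => ?_
    rw [← card_filter]
    exact card_filter_map_inter_map_eq_le E φ
  refine le_trans (card_le_card fun p hp => ?_) ((card_union_le _ _).trans (by gcongr))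
  simp only [partialOverlaps, mem_union, mem_filter] at hp ⊢
  grind

theorem card_link_union_link [DecidableEq U] {φ ψ : U ↪ V} {i j : U} (hij : φ i = ψ j)
    (hφψ : #(univ.map φ ∩ univ.map ψ) ≤ 1) :
    #(link φ i ∪ link ψ j) = 2 * (Fintype.card U - 1) := by
  rw [card_union_of_disjoint, card_link, card_link, two_mul]
  refine disjoint_left.2 fun v hv hv' => ?_
  simp only [link, Finset.mem_map, mem_erase, mem_univ, and_true] at hv hv'
  obtain ⟨⟨a, ha, rfl⟩, b, -, hab⟩ := And.intro hv hv'
  refine ha (φ.injective (card_le_one.1 hφψ _ ?_ _ ?_))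
  · exact mem_inter.2 ⟨by simp, by simp [← hab]⟩
  · exact mem_inter.2 ⟨by simp, by simp [hij]⟩

/-- In a pair of incidences with the same vertex, one of the positions determines the other. -/
theorem card_incidence_pairs_one_lt_overlap_le (E : Finset (U ↪ V)) :
    #{p ∈ incidences E ×ˢ incidences E | p.1.1 p.1.2 = p.2.1 p.2.2 ∧
      1 < #(univ.map p.1.1 ∩ univ.map p.2.1)} ≤
      Fintype.card U * (#(partialOverlaps E) + #E * Fintype.card U ^ Fintype.card U) := by
  refine le_trans ?_ (Nat.mul_le_mul_left _ (card_filter_one_lt_overlap_le E))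
  rw [← card_univ, ← card_product]
  refine card_le_card_of_injOn (fun p => (p.1.2, p.1.1, p.2.1)) (fun p hp => ?_) ?_
  · simp only [incidences, coe_filter, mem_product, Set.mem_ofPred_eq] at hp
    simp [hp.1.1.1, hp.1.2.1, hp.2.2]
  · rintro ⟨⟨φ, i⟩, ψ, j⟩ hp ⟨⟨φ', i'⟩, ψ', j'⟩ hp' heq
    obtain ⟨rfl, rfl, rfl⟩ := by simpa only [Prod.mk.injEq] using heq
    have hij : φ i = ψ j := (mem_filter.1 hp).2.1
    have hij' : φ i = ψ j' := (mem_filter.1 hp').2.1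
    rw [ψ.injective (hij.symm.trans hij')]

theorem sum_pow_card_link_union_link_le [Fintype V] [DecidableEq U] {E : Finset (U ↪ V)} {k : ℕ}
    (hE : IsRegularFamily E k) {q : ℝ} (hq : q ∈ Set.Icc 0 1) :
    ∑ p ∈ incidences E ×ˢ incidences E with p.1.1 p.1.2 = p.2.1 p.2.2,
        q ^ #(link p.1.1 p.1.2 ∪ link p.2.1 p.2.2) ≤
      k ^ 2 * Fintype.card V * q ^ (2 * (Fintype.card U - 1)) +
        Fintype.card U * (#(partialOverlaps E) + #E * Fintype.card U ^ Fintype.card U) := by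
  have hterm : ∀ p ∈ {p ∈ incidences E ×ˢ incidences E | p.1.1 p.1.2 = p.2.1 p.2.2},
      q ^ #(link p.1.1 p.1.2 ∪ link p.2.1 p.2.2) ≤ q ^ (2 * (Fintype.card U - 1)) +
        if 1 < #(univ.map p.1.1 ∩ univ.map p.2.1) then 1 else 0 := fun p hp => by
    split_ifs with hoverlap
    · exact (pow_le_one₀ hq.1 hq.2).trans (le_add_of_nonneg_left (pow_nonneg hq.1 _))
    · rw [card_link_union_link (mem_filter.1 hp).2 (not_lt.1 hoverlap), add_zero]
  refine (sum_le_sum hterm).trans ?_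
  rw [sum_add_distrib, sum_boole, filter_filter, sum_const, hE.card_incidence_pairs_eq]
  push_cast [nsmul_eq_mul]
  gcongr
  exact_mod_cast card_incidence_pairs_one_lt_overlap_le E

theorem IsRegularFamily.exists_pinning_set [Fintype V] [DecidableEq U] {E : Finset (U ↪ V)}
    {k : ℕ} (hE : IsRegularFamily E k) {g : V → Finset V → ℝ}
    (hg : ∀ v F, g v F ∈ Set.Icc 0 1) (hmono : ∀ v, Monotone (g v)) {q C : ℝ}
    (hq : q ∈ Set.Icc 0 1) (hC : 0 ≤ C) :
    ∃ F : Finset V, C * #F ≤ Fintype.card V ∧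
      (q ^ (Fintype.card U - 1) *
        ∑ φ ∈ E, ∑ i, (g (φ i) (F ∪ link φ i) - g (φ i) F)) ^ 2 ≤
        C * q * Fintype.card V * (k ^ 2 * Fintype.card V * q ^ (2 * (Fintype.card U - 1)) +
          Fintype.card U * (#(partialOverlaps E) + #E * Fintype.card U ^ Fintype.card U)) := by
  obtain ⟨F, hF, hgain⟩ := exists_pinning_set_of_rooted (incidences E) (fun a => a.1 a.2)
    (fun a => link a.1 a.2) hg hmono hq hC
  refine ⟨F, hF, ?_⟩
  simp only [card_link, ← mul_sum, incidences, sum_product] at hgain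
  have hnonneg : 0 ≤ C * q * Fintype.card V :=
    mul_nonneg (mul_nonneg hC hq.1) (Nat.cast_nonneg _)
  exact hgain.trans (mul_le_mul_of_nonneg_left (sum_pow_card_link_union_link_le hE hq) hnonneg)

/-- `E` has many embeddings per element of `V` and few pairs of embeddings with partially
overlapping images; a quantitative form, for a single pair of sets, of the notion of a good
set-sequence. -/
def IsSpread [Fintype V] (E : Finset (U ↪ V)) (σ : ℝ) : Prop :=
  Fintype.card V ≤ σ * #E ∧ Fintype.card V * #(partialOverlaps E) ≤ σ * #E ^ 2

theorem exists_pinning_set_of_isSpread (U : Type*) [Fintype U] [DecidableEq U] {C τ : ℝ}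
    (hC : 0 ≤ C) (hτ : 0 < τ) :
    ∃ σ : ℝ, 0 < σ ∧ ∀ (V : Type u) [Fintype V] [DecidableEq V] (E : Finset (U ↪ V)) (k : ℕ),
      IsRegularFamily E k → IsSpread E σ → ∀ g : V → Finset V → ℝ,
      (∀ v F, g v F ∈ Set.Icc 0 1) → (∀ v, Monotone (g v)) →
      ∃ F : Finset V, C * #F ≤ Fintype.card V ∧
        ∑ φ ∈ E, ∑ i, (g (φ i) (F ∪ link φ i) - g (φ i) F) ≤ τ * #E := by
  set r := Fintype.card U
  obtain ⟨q, hq0, hq⟩ := exists_pos_mul_lt (lt_min one_pos (half_pos (pow_pos hτ 2)))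
    (1 + C * r ^ 2)
  have hCr : 0 ≤ C * r ^ 2 * q := by positivity
  have hq1 : q ≤ 1 := by linarith [hq.trans_le (min_le_left _ _)]
  have hqτ : C * q * r ^ 2 ≤ τ ^ 2 / 2 := by linarith [hq.trans_le (min_le_right _ _)]
  set Q := q ^ (r - 1)
  have hQ : 0 < Q := pow_pos hq0 _
  obtain ⟨σ, hσ0, hσ⟩ := exists_pos_mul_lt (half_pos (pow_pos (mul_pos hQ hτ) 2))
    (C * q * r * (1 + r ^ r))
  refine ⟨σ, hσ0, fun V _ _ E k hE ⟨hcard, hoverlap⟩ g hg hmono => ?_⟩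
  obtain ⟨F, hF, hgain⟩ := hE.exists_pinning_set hg hmono ⟨hq0.le, hq1⟩ hC
  refine ⟨F, hF, ?_⟩
  have hkV : (k * Fintype.card V : ℝ) = r * #E := mod_cast hE.card_mul_card_eq.symm
  have hbound : (Fintype.card V : ℝ) * (#(partialOverlaps E) + #E * r ^ r) ≤
      σ * #E ^ 2 * (1 + r ^ r) := by
    have := mul_le_mul_of_nonneg_right hcard (by positivity : (0 : ℝ) ≤ #E * r ^ r)
    nlinarith
  have hsq : (Q * ∑ φ ∈ E, ∑ i, (g (φ i) (F ∪ link φ i) - g (φ i) F)) ^ 2 ≤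
      (Q * (τ * #E)) ^ 2 := by
    calc _ ≤ _ := hgain
      _ = C * q * (k * Fintype.card V) ^ 2 * Q ^ 2 +
            C * q * r * (Fintype.card V * (#(partialOverlaps E) + #E * r ^ r)) := by
          rw [mul_comm 2, pow_mul]; ring
      _ ≤ C * q * (r * #E) ^ 2 * Q ^ 2 + C * q * r * (σ * #E ^ 2 * (1 + r ^ r)) := by
          rw [hkV]; gcongr
      _ = (C * q * r ^ 2) * (Q ^ 2 * #E ^ 2) + C * q * r * (1 + r ^ r) * σ * #E ^ 2 := by ring
      _ ≤ τ ^ 2 / 2 * (Q ^ 2 * #E ^ 2) + (Q * τ) ^ 2 / 2 * #E ^ 2 := by gcongr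
      _ = (Q * (τ * #E)) ^ 2 := by ring
  exact le_of_mul_le_mul_left (le_of_sq_le_sq hsq (by positivity)) hQ

end Pinning

section ConditionalMean

open Finset

variable {V K : Type*} [DecidableEq K]

section

variable [Fintype V] [Fintype K] [DecidableEq V]

/-- The sum of `f` over the colourings that agree with `x` on `G`. -/
def fibreSum (f : (V → K) → ℝ) (G : Finset V) (x : V → K) : ℝ := ∑ y with ∀ v ∈ G, y v = x v, f y

theorem dependsOn_fibreSum (f : (V → K) → ℝ) (G : Finset V) : DependsOn (fibreSum f G) G :=
  fun _ _ hxy => sum_congr (filter_congr fun _ _ => forall₂_congr fun v hv => by rw [hxy v hv])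
    fun _ _ => rfl

theorem sum_fibreSum_mul (f g : (V → K) → ℝ) (G : Finset V) :
    ∑ x, fibreSum f G x * g x = ∑ x, f x * fibreSum g G x := by
  simp only [fibreSum, sum_mul, mul_sum, sum_filter]
  rw [sum_comm]
  refine sum_congr rfl fun y _ => sum_congr rfl fun x _ => ?_
  simp only [eq_comm (a := y _), ite_mul, mul_ite, zero_mul, mul_zero]

theorem fibreSum_mul_of_dependsOn (f : (V → K) → ℝ) {u : (V → K) → ℝ} {G : Finset V}
    (hu : DependsOn u G) (x : V → K) :
    fibreSum (fun y => f y * u y) G x = fibreSum f G x * u x := by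
  rw [fibreSum, fibreSum, sum_mul]
  exact sum_congr rfl fun y hy => by rw [hu fun v hv => (mem_filter.1 hy).2 v hv]

variable {μ : (V → K) → ℝ}

theorem fibreSum_nonneg (hμ : 0 ≤ μ) (G : Finset V) (x : V → K) : 0 ≤ fibreSum μ G x :=
  sum_nonneg fun y _ => hμ y

theorem le_fibreSum (hμ : 0 ≤ μ) (G : Finset V) (x : V → K) : μ x ≤ fibreSum μ G x :=
  single_le_sum (fun y _ => hμ y) (mem_filter.2 ⟨mem_univ x, fun _ _ => rfl⟩)

/-- The conditional expectation of `f` given the coordinates in `G`, for the weights `μ`. It is `0`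
where the coordinates in `G` have weight `0`. -/
noncomputable def condMean (μ : (V → K) → ℝ) (G : Finset V) (f : (V → K) → ℝ) (x : V → K) : ℝ :=
  fibreSum (fun y => μ y * f y) G x / fibreSum μ G x

theorem dependsOn_condMean (μ : (V → K) → ℝ) (G : Finset V) (f : (V → K) → ℝ) :
    DependsOn (condMean μ G f) G := fun _ _ hxy => by
  rw [condMean, condMean, dependsOn_fibreSum _ G hxy, dependsOn_fibreSum _ G hxy]

theorem sum_mul_condMean_mul (hμ : 0 ≤ μ) {G : Finset V} (f : (V → K) → ℝ)
    {h : (V → K) → ℝ} (hh : DependsOn h G) :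
    ∑ x, μ x * condMean μ G f x * h x = ∑ x, μ x * f x * h x := by
  have hu : DependsOn (fun x => h x / fibreSum μ G x) G := fun x y hxy =>
    congrArg₂ (· / ·) (hh hxy) (dependsOn_fibreSum μ G hxy)
  calc ∑ x, μ x * condMean μ G f x * h x
      = ∑ x, fibreSum (fun y => μ y * f y) G x * (μ x * (h x / fibreSum μ G x)) :=
        sum_congr rfl fun x _ => by rw [condMean]; ring
    _ = ∑ x, μ x * f x * (fibreSum μ G x * (h x / fibreSum μ G x)) := by
        simp only [sum_fibreSum_mul, fibreSum_mul_of_dependsOn μ hu]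
    _ = ∑ x, μ x * f x * h x := sum_congr rfl fun x _ => by
        rcases (hμ x).eq_or_lt with hx | hx
        · simp [← hx]
        · rw [mul_div_cancel₀ _ (hx.trans_le (le_fibreSum hμ G x)).ne']

/-- Pythagoras' theorem for nested conditional expectations. -/
theorem sum_mul_sub_condMean_sq (hμ : 0 ≤ μ) {G G' : Finset V} (hG : G ⊆ G')
    (f : (V → K) → ℝ) :
    ∑ x, μ x * (condMean μ G' f x - condMean μ G f x) ^ 2 =
      ∑ x, μ x * condMean μ G' f x ^ 2 - ∑ x, μ x * condMean μ G f x ^ 2 := by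
  have hcoarse := sum_mul_condMean_mul hμ f (dependsOn_condMean μ G f)
  have hfine := sum_mul_condMean_mul hμ (G := G') f (h := condMean μ G f)
    fun _ _ hxy => dependsOn_condMean μ G f fun v hv => hxy v (hG hv)
  have hexpand : ∀ x, μ x * (condMean μ G' f x - condMean μ G f x) ^ 2 =
      μ x * condMean μ G' f x ^ 2 - 2 * (μ x * condMean μ G' f x * condMean μ G f x) +
        μ x * condMean μ G f x * condMean μ G f x := fun x => by ring
  have hsq : ∀ x, μ x * condMean μ G f x ^ 2 = μ x * condMean μ G f x * condMean μ G f x :=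
    fun x => by ring
  simp only [hexpand, hsq, sum_add_distrib, sum_sub_distrib, ← mul_sum]
  linarith

end

/-- The indicator of the colourings in which `v` has colour `a`. -/
def colourIndicator (v : V) (a : K) (x : V → K) : ℝ := if x v = a then 1 else 0

theorem colourIndicator_mem_Icc (v : V) (a : K) (x : V → K) :
    colourIndicator v a x ∈ Set.Icc 0 1 := by
  unfold colourIndicator
  split_ifs <;> simp

theorem prod_colourIndicator {U : Type*} [Fintype U] [DecidableEq (U → K)] (φ : U → V) (a : U → K)
    (x : V → K) : ∏ i, colourIndicator (φ i) (a i) x = if x ∘ φ = a then 1 else 0 := by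
  simp only [colourIndicator, prod_ite_zero, prod_const_one, mem_univ, true_imp_iff, funext_iff,
    Function.comp_apply]

variable [Fintype V] [Fintype K] [DecidableEq V] {μ : (V → K) → ℝ}

/-- The conditional probability that `v` has colour `a`, given the colours of the elements
of `G`. -/
noncomputable def condProb (μ : (V → K) → ℝ) (G : Finset V) (v : V) (a : K) (x : V → K) : ℝ :=
  condMean μ G (colourIndicator v a) x

theorem condProb_nonneg (hμ : 0 ≤ μ) (G : Finset V) (v : V) (a : K) (x : V → K) :
    0 ≤ condProb μ G v a x :=
  div_nonneg (sum_nonneg fun y _ => mul_nonneg (hμ y) (colourIndicator_mem_Icc v a y).1)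
    (fibreSum_nonneg hμ G x)

theorem sum_condProb_eq_div (μ : (V → K) → ℝ) (G : Finset V) (v : V) (x : V → K) :
    ∑ a, condProb μ G v a x = fibreSum μ G x / fibreSum μ G x := by
  simp only [condProb, condMean, ← sum_div]
  simp only [fibreSum, sum_comm (s := univ (α := K)), colourIndicator, ← mul_sum]
  simp

theorem sum_condProb_le_one (μ : (V → K) → ℝ) (G : Finset V) (v : V) (x : V → K) :
    ∑ a, condProb μ G v a x ≤ 1 :=
  (sum_condProb_eq_div μ G v x).trans_le (div_self_le_one _)

theorem sum_condProb (hμ : 0 ≤ μ) (G : Finset V) (v : V) {x : V → K} (hx : 0 < μ x) :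
    ∑ a, condProb μ G v a x = 1 :=
  (sum_condProb_eq_div μ G v x).trans (div_self (hx.trans_le (le_fibreSum hμ G x)).ne')

theorem condProb_le_one (hμ : 0 ≤ μ) (G : Finset V) (v : V) (a : K) (x : V → K) :
    condProb μ G v a x ≤ 1 :=
  (single_le_sum (f := fun a => condProb μ G v a x) (fun b _ => condProb_nonneg hμ G v b x)
    (mem_univ a)).trans (sum_condProb_le_one μ G v x)

/-- The mean square of the conditional distribution of the colour of `v` given the colours of the
elements of `G`. -/
noncomputable def colourEnergy (μ : (V → K) → ℝ) (v : V) (G : Finset V) : ℝ :=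
  ∑ a, ∑ x, μ x * condProb μ G v a x ^ 2

theorem colourEnergy_nonneg (hμ : 0 ≤ μ) (v : V) (G : Finset V) : 0 ≤ colourEnergy μ v G :=
  sum_nonneg fun _ _ => sum_nonneg fun x _ => mul_nonneg (hμ x) (sq_nonneg _)

theorem colourEnergy_le_one (hμ : μ ∈ stdSimplex ℝ (V → K)) (v : V) (G : Finset V) :
    colourEnergy μ v G ≤ 1 := by
  rw [colourEnergy, sum_comm, ← hμ.2]
  refine sum_le_sum fun x _ => ?_
  rw [← mul_sum]
  refine mul_le_of_le_one_right (hμ.1 x) (le_trans ?_ (sum_condProb_le_one μ G v x))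
  exact sum_le_sum fun a _ => pow_le_of_le_one (condProb_nonneg hμ.1 G v a x)
    (condProb_le_one hμ.1 G v a x) two_ne_zero

theorem colourEnergy_sub (hμ : 0 ≤ μ) {G G' : Finset V} (hG : G ⊆ G') (v : V) :
    colourEnergy μ v G' - colourEnergy μ v G =
      ∑ a, ∑ x, μ x * (condProb μ G' v a x - condProb μ G v a x) ^ 2 := by
  rw [colourEnergy, colourEnergy, ← sum_sub_distrib]
  exact sum_congr rfl fun a _ => (sum_mul_sub_condMean_sq hμ hG (colourIndicator v a)).symm

theorem colourEnergy_mono (hμ : 0 ≤ μ) (v : V) : Monotone (colourEnergy μ v) := fun G G' hG => by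
  rw [← sub_nonneg, colourEnergy_sub hμ hG]
  exact sum_nonneg fun _ _ => sum_nonneg fun x _ => mul_nonneg (hμ x) (sq_nonneg _)

theorem sum_mul_sub_condProb_sq_le (hμ : 0 ≤ μ) {G G' : Finset V} (hG : G ⊆ G') (v : V) (a : K) :
    ∑ x, μ x * (condProb μ G' v a x - condProb μ G v a x) ^ 2 ≤
      colourEnergy μ v G' - colourEnergy μ v G := by
  rw [colourEnergy_sub hμ hG]
  exact single_le_sum (f := fun a => ∑ x, μ x * (condProb μ G' v a x - condProb μ G v a x) ^ 2)
    (fun _ _ => sum_nonneg fun x _ => mul_nonneg (hμ x) (sq_nonneg _)) (mem_univ a)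

end ConditionalMean

section NearIndependence

open Finset

theorem sum_mul_mul_le_sqrt {Ω : Type*} [Fintype Ω] {μ : Ω → ℝ} (hμ : μ ∈ stdSimplex ℝ Ω)
    (d : Ω → ℝ) {H : Ω → ℝ} (hH : ∀ x, H x ∈ Set.Icc 0 1) :
    ∑ x, μ x * d x * H x ≤ √(∑ x, μ x * d x ^ 2) := by
  have hnorm : ∑ x, μ x * H x ^ 2 ≤ 1 := hμ.2.symm ▸
    sum_le_sum fun x _ => mul_le_of_le_one_right (hμ.1 x) (pow_le_one₀ (hH x).1 (hH x).2)
  refine Real.le_sqrt_of_sq_le ?_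
  calc (∑ x, μ x * d x * H x) ^ 2 ≤ (∑ x, μ x * d x ^ 2) * ∑ x, μ x * H x ^ 2 :=
        sum_sq_le_sum_mul_sum_of_sq_le_mul univ (fun x _ => mul_nonneg (hμ.1 x) (sq_nonneg _))
          (fun x _ => mul_nonneg (hμ.1 x) (sq_nonneg _)) fun x _ => (by ring : _ = _).le
    _ ≤ ∑ x, μ x * d x ^ 2 :=
        mul_le_of_le_one_right (sum_nonneg fun x _ => mul_nonneg (hμ.1 x) (sq_nonneg _)) hnorm

/-- The factors of a product are replaced one at a time. -/
theorem sum_mul_prod_le_of_replace {U Ω : Type*} [Fintype U] [DecidableEq U] [Fintype Ω]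
    (μ : Ω → ℝ) (f g : U → Ω → ℝ) (w : U → ℝ)
    (hstep : ∀ j s, j ∉ s →
      ∑ x, μ x * f j x * ((∏ i ∈ s, f i x) * ∏ i ∈ (insert j s)ᶜ, g i x) ≤
        ∑ x, μ x * g j x * ((∏ i ∈ s, f i x) * ∏ i ∈ (insert j s)ᶜ, g i x) + w j) :
    ∑ x, μ x * ∏ i, f i x ≤ ∑ x, μ x * ∏ i, g i x + ∑ i, w i := by
  suffices hpartial : ∀ s : Finset U, ∑ x, μ x * ((∏ i ∈ s, f i x) * ∏ i ∈ sᶜ, g i x) ≤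
      ∑ x, μ x * ∏ i, g i x + ∑ i ∈ s, w i by
    simpa using hpartial univ
  intro s
  induction s using Finset.induction with
  | empty => simp
  | insert j s hj ih =>
    have hcompl : sᶜ = insert j (insert j s)ᶜ := by
      rw [compl_insert, insert_erase (mem_compl.2 hj)]
    calc ∑ x, μ x * ((∏ i ∈ insert j s, f i x) * ∏ i ∈ (insert j s)ᶜ, g i x)
        = ∑ x, μ x * f j x * ((∏ i ∈ s, f i x) * ∏ i ∈ (insert j s)ᶜ, g i x) :=
          sum_congr rfl fun x _ => by rw [prod_insert hj]; ring
      _ ≤ ∑ x, μ x * g j x * ((∏ i ∈ s, f i x) * ∏ i ∈ (insert j s)ᶜ, g i x) + w j :=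
          hstep j s hj
      _ = ∑ x, μ x * ((∏ i ∈ s, f i x) * ∏ i ∈ sᶜ, g i x) + w j := by
          refine congrArg (· + w j) (sum_congr rfl fun x _ => ?_)
          rw [hcompl, prod_insert (by simp)]
          ring
      _ ≤ ∑ x, μ x * ∏ i, g i x + ∑ i ∈ insert j s, w i := by
          rw [sum_insert hj]
          linarith

variable {V K : Type*} [Fintype V] [Fintype K] [DecidableEq V] [DecidableEq K] {μ : (V → K) → ℝ}

theorem sum_mul_condProb_mul_le (hμ : μ ∈ stdSimplex ℝ (V → K)) {F G : Finset V} (hFG : F ⊆ G)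
    (v : V) (a : K) {H : (V → K) → ℝ} (hHG : DependsOn H G) (hH : ∀ x, H x ∈ Set.Icc 0 1) :
    ∑ x, μ x * condProb μ F v a x * H x ≤
      ∑ x, μ x * colourIndicator v a x * H x + √(colourEnergy μ v G - colourEnergy μ v F) := by
  rw [← sum_mul_condMean_mul hμ.1 (colourIndicator v a) hHG, ← sub_le_iff_le_add',
    ← sum_sub_distrib]
  calc _ = ∑ x, μ x * (condProb μ F v a x - condProb μ G v a x) * H x :=
        sum_congr rfl fun x _ => by rw [← condProb]; ring
    _ ≤ √(∑ x, μ x * (condProb μ F v a x - condProb μ G v a x) ^ 2) := sum_mul_mul_le_sqrt hμ _ hH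
    _ ≤ √(colourEnergy μ v G - colourEnergy μ v F) := by
        simp only [sub_sq_comm (condProb μ F v a _)]
        exact Real.sqrt_le_sqrt (sum_mul_sub_condProb_sq_le hμ.1 hFG v a)

variable {U : Type*} [Fintype U]

theorem sum_mul_prod_condProb_le [DecidableEq U] (hμ : μ ∈ stdSimplex ℝ (V → K))
    (F : Finset V) (φ : U ↪ V) (a : U → K) :
    ∑ x, μ x * ∏ i, condProb μ F (φ i) (a i) x ≤
      ∑ x, μ x * ∏ i, colourIndicator (φ i) (a i) x +
        ∑ i, √(colourEnergy μ (φ i) (F ∪ link φ i) - colourEnergy μ (φ i) F) := by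
  refine sum_mul_prod_le_of_replace μ (fun i => condProb μ F (φ i) (a i))
    (fun i => colourIndicator (φ i) (a i)) _ fun j s _ => ?_
  refine sum_mul_condProb_mul_le hμ subset_union_left (φ j) (a j) (fun x z hxz => ?_) fun x => ?_
  · refine congrArg₂ (· * ·) (prod_congr rfl fun i _ => ?_) (prod_congr rfl fun i hi => ?_)
    · exact dependsOn_condMean _ _ _ fun v hv => hxz v (mem_union_left _ hv)
    · have hij : i ≠ j := fun hij => mem_compl.1 hi (hij ▸ mem_insert_self j s)
      have hφi : φ i ∈ F ∪ link φ j := mem_union_right _ (by simp [link, hij])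
      simp only [colourIndicator, hxz _ hφi]
  · have hprob : ∀ i, condProb μ F (φ i) (a i) x ∈ Set.Icc 0 1 := fun i =>
      ⟨condProb_nonneg hμ.1 F _ _ x, condProb_le_one hμ.1 F _ _ x⟩
    have hind := fun i => colourIndicator_mem_Icc (φ i) (a i) x
    have hnonneg := prod_nonneg fun i (_ : i ∈ (insert j s)ᶜ) => (hind i).1
    exact ⟨mul_nonneg (prod_nonneg fun i _ => (hprob i).1) hnonneg,
      mul_le_one₀ (prod_le_one (fun i _ => (hprob i).1) fun i _ => (hprob i).2) hnonneg
        (prod_le_one (fun i _ => (hind i).1) fun i _ => (hind i).2)⟩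

theorem sum_mul_sum_prod_condProb_le [DecidableEq U] (hμ : μ ∈ stdSimplex ℝ (V → K))
    (F : Finset V) (φ : U ↪ V) (Q : Finset (U → K)) :
    ∑ x, μ x * ∑ a ∈ Q, ∏ i, condProb μ F (φ i) (a i) x ≤
      ∑ x with x ∘ φ ∈ Q, μ x + Fintype.card K ^ Fintype.card U *
        ∑ i, √(colourEnergy μ (φ i) (F ∪ link φ i) - colourEnergy μ (φ i) F) := by
  set w := ∑ i, √(colourEnergy μ (φ i) (F ∪ link φ i) - colourEnergy μ (φ i) F)
  have hcard : (#Q : ℝ) ≤ Fintype.card K ^ Fintype.card U := by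
    exact_mod_cast (card_le_univ Q).trans_eq Fintype.card_fun
  calc _ = ∑ a ∈ Q, ∑ x, μ x * ∏ i, condProb μ F (φ i) (a i) x := by
        simp only [mul_sum]
        rw [sum_comm]
    _ ≤ ∑ a ∈ Q, (∑ x, μ x * ∏ i, colourIndicator (φ i) (a i) x + w) :=
        sum_le_sum fun a _ => sum_mul_prod_condProb_le hμ F φ a
    _ = ∑ x with x ∘ φ ∈ Q, μ x + #Q * w := by
        rw [sum_add_distrib, sum_comm, sum_const, nsmul_eq_mul]
        simp [prod_colourIndicator, sum_filter]
    _ ≤ _ := by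
        gcongr

theorem sum_sum_sqrt_le {ι : Type*} (E : Finset ι) {w : ι → U → ℝ} (hw : ∀ φ i, 0 ≤ w φ i)
    {τ : ℝ} (hτ : ∑ φ ∈ E, ∑ i, w φ i ≤ τ * #E) :
    ∑ φ ∈ E, ∑ i, √(w φ i) ≤ √(Fintype.card U * τ) * #E := by
  rw [← Real.sqrt_sq (Nat.cast_nonneg #E), ← Real.sqrt_mul' _ (sq_nonneg _)]
  refine Real.le_sqrt_of_sq_le ?_
  simp only [← sum_product']
  calc (∑ z ∈ E ×ˢ univ, √(w z.1 z.2)) ^ 2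
      ≤ #(E ×ˢ univ (α := U)) * ∑ z ∈ E ×ˢ univ, √(w z.1 z.2) ^ 2 := sq_sum_le_card_mul_sum_sq
    _ = #E * Fintype.card U * ∑ φ ∈ E, ∑ i, w φ i := by
        simp [Real.sq_sqrt (hw _ _), sum_product]
    _ ≤ #E * Fintype.card U * (τ * #E) := by gcongr
    _ = Fintype.card U * τ * #E ^ 2 := by ring

variable (U K) in
theorem exists_pinning_set_condProb {C τ : ℝ} (hC : 0 ≤ C) (hτ : 0 < τ) :
    ∃ σ : ℝ, 0 < σ ∧ ∀ (V : Type u) [Fintype V] [DecidableEq V] (E : Finset (U ↪ V)) (k : ℕ),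
      IsRegularFamily E k → IsSpread E σ → ∀ μ ∈ stdSimplex ℝ (V → K), ∀ Q : Finset (U → K),
      ∃ F : Finset V, C * #F ≤ Fintype.card V ∧
        ∑ φ ∈ E, ∑ x, μ x * ∑ a ∈ Q, ∏ i, condProb μ F (φ i) (a i) x ≤
          ∑ φ ∈ E, ∑ x with x ∘ φ ∈ Q, μ x + τ * #E := by
  classical
  set M : ℝ := Fintype.card K ^ Fintype.card U
  have hM : 0 ≤ M := by positivity
  obtain ⟨τ', hτ'0, hτ'⟩ := exists_pos_mul_lt (pow_pos hτ 2) (M ^ 2 * Fintype.card U)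
  obtain ⟨σ, hσ0, hσ⟩ := exists_pinning_set_of_isSpread.{u} U hC hτ'0
  refine ⟨σ, hσ0, fun V _ _ E k hE hspread μ hμ Q => ?_⟩
  obtain ⟨F, hF, hgain⟩ := hσ V E k hE hspread (colourEnergy μ)
    (fun v F => ⟨colourEnergy_nonneg hμ.1 v F, colourEnergy_le_one hμ v F⟩)
    (colourEnergy_mono hμ.1)
  refine ⟨F, hF, (sum_le_sum fun φ _ => sum_mul_sum_prod_condProb_le hμ F φ Q).trans ?_⟩
  rw [sum_add_distrib, ← mul_sum]
  refine add_le_add_right ?_ _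
  calc M * ∑ φ ∈ E, ∑ i, √(colourEnergy μ (φ i) (F ∪ link φ i) - colourEnergy μ (φ i) F)
      ≤ M * (√(Fintype.card U * τ') * #E) := by
        gcongr
        exact sum_sum_sqrt_le E (fun φ i => sub_nonneg.2
          (colourEnergy_mono hμ.1 (φ i) subset_union_left)) hgain
    _ = √(M ^ 2 * Fintype.card U * τ') * #E := by
        rw [mul_assoc (M ^ 2), Real.sqrt_mul (sq_nonneg M), Real.sqrt_sq hM, mul_assoc]
    _ ≤ τ * #E := by
        gcongr
        exact Real.sqrt_le_iff.2 ⟨hτ.le, hτ'.le⟩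

end NearIndependence

section Gibbs

open Finset

theorem sum_mul_log_le_neg_log {Ω : Type*} [Fintype Ω] {μ π L : Ω → ℝ} (hμ : μ ∈ stdSimplex ℝ Ω)
    {W : ℝ} (hW : 0 < W) (hWμ : ∀ x, W * μ x ≤ π x) (hL : ∀ x, 0 < L x)
    (hπL : ∑ x, π x * L x ≤ 1) : ∑ x, μ x * Real.log (L x) ≤ -Real.log W := by
  have hpoint : ∀ x, μ x * Real.log (L x) ≤ μ x * (-Real.log W - 1) + π x * L x := fun x => by
    have hlog := Real.log_le_sub_one_of_pos (mul_pos hW (hL x))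
    rw [Real.log_mul hW.ne' (hL x).ne'] at hlog
    have := mul_le_mul_of_nonneg_left hlog (hμ.1 x)
    have := mul_le_mul_of_nonneg_right (hWμ x) (hL x).le
    linarith
  refine (sum_le_sum fun x _ => hpoint x).trans ?_
  rw [sum_add_distrib, ← sum_mul, hμ.2]
  linarith

section

variable {V K : Type*} [Fintype V] [Fintype K] [DecidableEq V] [DecidableEq K]

theorem fibreSum_prod (g : V → K → ℝ) (F : Finset V) (y : V → K) :
    fibreSum (fun x => ∏ v, g v (x v)) F y = (∏ v ∈ F, g v (y v)) * ∏ v ∈ Fᶜ, ∑ a, g v a := by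
  have hfibre : ({x | ∀ v ∈ F, x v = y v} : Finset (V → K)) =
      Fintype.piFinset fun v => if v ∈ F then {y v} else univ := by
    ext x
    simp only [mem_filter, mem_univ, true_and, Fintype.mem_piFinset]
    refine forall_congr' fun v => ?_
    split_ifs with hv <;> simp [hv]
  rw [fibreSum, hfibre, ← prod_univ_sum, ← prod_mul_prod_compl F]
  refine congrArg₂ (· * ·) (prod_congr rfl fun v hv => ?_) (prod_congr rfl fun v hv => ?_)
  · rw [if_pos hv, sum_singleton]
  · rw [if_neg (mem_compl.1 hv)]

end

variable {V K : Type*} [Fintype V] [Fintype K] [DecidableEq V]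
  {p : K → ℝ} {F : Finset V} {ℓ : V → (V → K) → K → ℝ}

theorem sum_prod_mul_prod_density_le_one (hp : p ∈ stdSimplex ℝ K) (hℓ0 : ∀ v x a, 0 ≤ ℓ v x a)
    (hdep : ∀ v, DependsOn (ℓ v) F) (hℓ : ∀ v x, ∑ a, p a * ℓ v x a ≤ 1) :
    ∑ x : V → K, (∏ v, p (x v)) * ∏ v ∈ Fᶜ, ℓ v x (x v) ≤ 1 := by
  classical
  set π : (V → K) → ℝ := fun x => ∏ v, p (x v)
  have hπ : 0 ≤ π := fun x => prod_nonneg fun v _ => hp.1 (x v)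
  have hcond : ∀ y, condMean π F (fun x => ∏ v ∈ Fᶜ, ℓ v x (x v)) y ≤ 1 := fun y => by
    refine div_le_one_of_le₀ ?_ (fibreSum_nonneg hπ F y)
    calc fibreSum (fun x => π x * ∏ v ∈ Fᶜ, ℓ v x (x v)) F y
        = fibreSum (fun x => ∏ v, p (x v) * if v ∈ F then 1 else ℓ v y (x v)) F y := by
          refine sum_congr rfl fun x hx => ?_
          dsimp only
          rw [prod_mul_distrib, ← prod_mul_prod_compl F fun v => if v ∈ F then _ else _,
            prod_congr rfl fun v hv => if_pos hv, prod_const_one, one_mul]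
          refine congrArg (π x * ·) (prod_congr rfl fun v hv => ?_)
          rw [if_neg (mem_compl.1 hv), hdep v fun u hu => (mem_filter.1 hx).2 u hu]
      _ = (∏ v ∈ F, p (y v)) * ∏ v ∈ Fᶜ, ∑ a, p a * ℓ v y a := by
          rw [fibreSum_prod fun v a => p a * if v ∈ F then 1 else ℓ v y a]
          refine congrArg₂ (· * ·) (prod_congr rfl fun v hv => ?_) (prod_congr rfl fun v hv => ?_)
          · rw [if_pos hv, mul_one]
          · simp only [if_neg (mem_compl.1 hv)]
      _ ≤ ∏ v ∈ F, p (y v) :=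
          mul_le_of_le_one_right (prod_nonneg fun v _ => hp.1 _) (prod_le_one
            (fun v _ => sum_nonneg fun a _ => mul_nonneg (hp.1 a) (hℓ0 v y a)) fun v _ => hℓ v y)
      _ = fibreSum π F y := by
          simp only [π, fibreSum_prod fun _ => p, hp.2, prod_const_one, mul_one]
  have htower := sum_mul_condMean_mul hπ (G := F) (fun x => ∏ v ∈ Fᶜ, ℓ v x (x v))
    (h := fun _ => 1) fun _ _ _ => rfl
  simp only [mul_one] at htower
  rw [← htower]
  refine (sum_le_sum fun x _ => mul_le_of_le_one_right (hπ x) (hcond x)).trans_eq ?_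
  rw [← Fintype.prod_sum fun _ : V => p]
  simp [hp.2]

theorem sum_mul_log_density_le (hp : p ∈ stdSimplex ℝ K) (hℓ0 : ∀ v x a, 0 < ℓ v x a)
    (hdep : ∀ v, DependsOn (ℓ v) F) (hℓ : ∀ v x, ∑ a, p a * ℓ v x a ≤ 1) {μ : (V → K) → ℝ}
    (hμ : μ ∈ stdSimplex ℝ (V → K)) {W : ℝ} (hW : 0 < W) (hWμ : ∀ x, W * μ x ≤ ∏ v, p (x v)) :
    ∑ v ∈ Fᶜ, ∑ x, μ x * Real.log (ℓ v x (x v)) ≤ -Real.log W := by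
  refine le_trans (le_of_eq ?_) (sum_mul_log_le_neg_log hμ hW hWμ
    (fun x => prod_pos fun v _ => hℓ0 v x (x v))
    (sum_prod_mul_prod_density_le_one hp (fun v x a => (hℓ0 v x a).le) hdep hℓ))
  rw [sum_comm]
  refine sum_congr rfl fun x _ => ?_
  rw [← mul_sum, Real.log_prod fun v _ => (hℓ0 v x (x v)).ne']

end Gibbs

section Containers

open Finset

variable {V K : Type*} [Fintype V] [Fintype K] [DecidableEq V] [DecidableEq K]

open Classical in
/-- The colours available at `v` given the colours of the pinned set `F`: those whose conditional
density with respect to the weights `p` is at least `θ`. Pinned elements get all colours. -/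
noncomputable def container (μ : (V → K) → ℝ) (p : K → ℝ) (θ : ℝ) (F : Finset V) (v : V)
    (x : V → K) : Finset K :=
  if v ∈ F then univ else univ.filter fun a => θ * p a ≤ condProb μ F v a x

/-- The entropy of the container at `v`. -/
noncomputable def containerEntropy (μ : (V → K) → ℝ) (p : K → ℝ) (θ : ℝ) (F : Finset V) (v : V)
    (x : V → K) : ℝ :=
  -Real.log (∑ a ∈ container μ p θ F v x, p a)

/-- The density of the uniform distribution on the container at `v`, mixed with a small multiple
of the uniform distribution on all colours; the mixing keeps the density positive outside the
container. -/
noncomputable def containerDensity (μ : (V → K) → ℝ) (p : K → ℝ) (θ : ℝ) (F : Finset V) (v : V)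
    (x : V → K) (a : K) : ℝ :=
  (if a ∈ container μ p θ F v x then (1 - θ) / ∑ b ∈ container μ p θ F v x, p b else 0) + θ

variable {μ : (V → K) → ℝ} {p : K → ℝ} {θ : ℝ} {F : Finset V} {v : V}

theorem container_of_mem (hv : v ∈ F) (x : V → K) : container μ p θ F v x = univ :=
  if_pos hv

theorem mem_container (hv : v ∉ F) {x : V → K} {a : K} :
    a ∈ container μ p θ F v x ↔ θ * p a ≤ condProb μ F v a x := by
  simp [container, hv]

theorem dependsOn_container (μ : (V → K) → ℝ) (p : K → ℝ) (θ : ℝ) (F : Finset V) (v : V) :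
    DependsOn (container μ p θ F v) F := fun x y hxy => by
  ext a
  by_cases hv : v ∈ F
  · rw [container_of_mem hv, container_of_mem hv]
  · simp only [mem_container hv, condProb, dependsOn_condMean μ F _ hxy]

theorem dependsOn_containerEntropy (μ : (V → K) → ℝ) (p : K → ℝ) (θ : ℝ) (F : Finset V) (v : V) :
    DependsOn (containerEntropy μ p θ F v) F := fun _ _ hxy => by
  rw [containerEntropy, containerEntropy, dependsOn_container μ p θ F v hxy]

theorem dependsOn_containerDensity (μ : (V → K) → ℝ) (p : K → ℝ) (θ : ℝ) (F : Finset V) (v : V) :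
    DependsOn (containerDensity μ p θ F v) F := fun x y hxy => by
  ext a
  rw [containerDensity, containerDensity, dependsOn_container μ p θ F v hxy]

theorem sum_condProb_container_le_one (hμ : 0 ≤ μ) (x : V → K) :
    ∑ a ∈ container μ p θ F v x, condProb μ F v a x ≤ 1 :=
  (sum_le_sum_of_subset_of_nonneg (subset_univ _) fun a _ _ => condProb_nonneg hμ F v a x).trans
    (sum_condProb_le_one μ F v x)

theorem sum_condProb_container_ge (hμ : 0 ≤ μ) (hp : p ∈ stdSimplex ℝ K) (hθ : 0 ≤ θ) {x : V → K}
    (hx : 0 < μ x) : 1 - θ ≤ ∑ a ∈ container μ p θ F v x, condProb μ F v a x := by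
  have hsum := sum_condProb hμ F v hx
  by_cases hv : v ∈ F
  · rw [container_of_mem hv, hsum]
    linarith
  have hcompl : ∑ a ∈ (container μ p θ F v x)ᶜ, condProb μ F v a x ≤ θ := by
    calc ∑ a ∈ (container μ p θ F v x)ᶜ, condProb μ F v a x
        ≤ ∑ a ∈ (container μ p θ F v x)ᶜ, θ * p a := sum_le_sum fun a ha =>
          (not_le.1 fun h => mem_compl.1 ha ((mem_container hv).2 h)).le
      _ ≤ ∑ a, θ * p a := sum_le_sum_of_subset_of_nonneg (subset_univ _)
          fun a _ _ => mul_nonneg hθ (hp.1 a)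
      _ = θ := by rw [← mul_sum, hp.2, mul_one]
  rw [← sum_add_sum_compl (container μ p θ F v x)] at hsum
  linarith

theorem condProb_eq_zero (hac : ∀ x, ∏ v, p (x v) = 0 → μ x = 0) {a : K} (ha : p a = 0)
    (x : V → K) : condProb μ F v a x = 0 := by
  rw [condProb, condMean, fibreSum, sum_eq_zero, zero_div]
  intro y _
  unfold colourIndicator
  split_ifs with hy
  · rw [hac y (prod_eq_zero (mem_univ v) (hy ▸ ha)), zero_mul]
  · rw [mul_zero]

theorem sum_container_pos (hμ : 0 ≤ μ) (hp : p ∈ stdSimplex ℝ K) (hθ : θ ∈ Set.Ioo 0 1)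
    (hac : ∀ x, ∏ v, p (x v) = 0 → μ x = 0) {x : V → K} (hx : 0 < μ x) :
    0 < ∑ a ∈ container μ p θ F v x, p a := by
  refine (sum_nonneg fun a _ => hp.1 a).lt_of_ne' fun hzero => ?_
  have hvanish := (sum_eq_zero_iff_of_nonneg fun a _ => hp.1 a).1 hzero
  have hge := sum_condProb_container_ge (F := F) (v := v) hμ hp hθ.1.le hx
  rw [sum_eq_zero fun a ha => condProb_eq_zero hac (hvanish a ha) x] at hge
  linarith [hθ.2]

theorem sum_container_le_one (hp : p ∈ stdSimplex ℝ K) (x : V → K) :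
    ∑ a ∈ container μ p θ F v x, p a ≤ 1 :=
  (sum_le_sum_of_subset_of_nonneg (subset_univ _) fun a _ _ => hp.1 a).trans_eq hp.2

theorem containerEntropy_nonneg (hp : p ∈ stdSimplex ℝ K) (x : V → K) :
    0 ≤ containerEntropy μ p θ F v x :=
  neg_nonneg.2 (Real.log_nonpos (sum_nonneg fun a _ => hp.1 a) (sum_container_le_one hp x))

theorem containerEntropy_of_mem (hp : p ∈ stdSimplex ℝ K) (hv : v ∈ F) (x : V → K) :
    containerEntropy μ p θ F v x = 0 := by
  rw [containerEntropy, container_of_mem hv, hp.2, Real.log_one, neg_zero]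

theorem containerDensity_pos (hp : p ∈ stdSimplex ℝ K) (hθ : θ ∈ Set.Ioo 0 1) (x : V → K) (a : K) :
    0 < containerDensity μ p θ F v x a := by
  refine add_pos_of_nonneg_of_pos ?_ hθ.1
  split_ifs
  · exact div_nonneg (sub_nonneg.2 hθ.2.le) (sum_nonneg fun b _ => hp.1 b)
  · rfl

theorem sum_mul_containerDensity_le (hp : p ∈ stdSimplex ℝ K) (hθ : θ ≤ 1) (x : V → K) :
    ∑ a, p a * containerDensity μ p θ F v x a ≤ 1 := by
  simp only [containerDensity, mul_add, sum_add_distrib, mul_ite, mul_zero, sum_ite_mem,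
    univ_inter, ← sum_mul, hp.2, one_mul]
  rw [mul_div_left_comm]
  have := mul_le_of_le_one_right (sub_nonneg.2 hθ)
    (div_self_le_one (∑ b ∈ container μ p θ F v x, p b))
  linarith

theorem log_containerDensity_ge (hθ : θ ∈ Set.Ioo 0 1) {x : V → K}
    (hpos : 0 < ∑ a ∈ container μ p θ F v x, p a) (a : K) :
    (if a ∈ container μ p θ F v x then 1 else 0) *
        (containerEntropy μ p θ F v x + Real.log (1 - θ) - Real.log θ) + Real.log θ ≤
      Real.log (containerDensity μ p θ F v x a) := by
  have hθ' : 0 < 1 - θ := sub_pos.2 hθ.2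
  unfold containerDensity
  split_ifs
  · calc _ = Real.log ((1 - θ) / ∑ b ∈ container μ p θ F v x, p b) := by
          rw [Real.log_div hθ'.ne' hpos.ne', containerEntropy]
          ring
      _ ≤ _ := Real.log_le_log (div_pos hθ' hpos) (le_add_of_nonneg_right hθ.1.le)
  · simp

theorem sum_mul_mem_container_mul (hμ : 0 ≤ μ) {h : (V → K) → ℝ} (hh : DependsOn h F) :
    ∑ x, μ x * ((if x v ∈ container μ p θ F v x then 1 else 0) * h x) =
      ∑ x, μ x * ((∑ a ∈ container μ p θ F v x, condProb μ F v a x) * h x) := by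
  let available : K → (V → K) → ℝ := fun a x => if a ∈ container μ p θ F v x then 1 else 0
  have hcolour : ∀ x : V → K, μ x * ((if x v ∈ container μ p θ F v x then 1 else 0) * h x) =
      ∑ a, μ x * colourIndicator v a x * (available a x * h x) := fun x => by
    simp [available, colourIndicator]
  have hcond : ∀ x, μ x * ((∑ a ∈ container μ p θ F v x, condProb μ F v a x) * h x) =
      ∑ a, μ x * condProb μ F v a x * (available a x * h x) := fun x => by
    simp only [available, ite_mul, one_mul, zero_mul, mul_ite, mul_zero, sum_ite_mem, univ_inter,
      sum_mul, mul_sum, mul_assoc]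
  simp only [hcolour, hcond]
  rw [sum_comm, sum_comm (s := univ (α := V → K))]
  refine sum_congr rfl fun a _ => (sum_mul_condMean_mul hμ _ fun x y hxy => ?_).symm
  simp only [available, dependsOn_container μ p θ F v hxy, hh hxy]

theorem sum_mul_log_containerDensity_ge (hμ : μ ∈ stdSimplex ℝ (V → K)) (hp : p ∈ stdSimplex ℝ K)
    (hθ : θ ∈ Set.Ioo 0 1) (hac : ∀ x, ∏ v, p (x v) = 0 → μ x = 0) :
    (1 - θ) * (∑ x, μ x * containerEntropy μ p θ F v x) +
        (Real.log (1 - θ) + θ * Real.log θ) ≤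
      ∑ x, μ x * Real.log (containerDensity μ p θ F v x (x v)) := by
  let s := containerEntropy μ p θ F v
  let h : (V → K) → ℝ := fun x => s x + Real.log (1 - θ) - Real.log θ
  let prob : (V → K) → ℝ := fun x => ∑ a ∈ container μ p θ F v x, condProb μ F v a x
  have hh : DependsOn h F := fun x y hxy => by
    simp only [h, s, dependsOn_containerEntropy μ p θ F v hxy]
  have hlog : Real.log θ < 0 ∧ Real.log (1 - θ) < 0 :=
    ⟨Real.log_neg hθ.1 hθ.2, Real.log_neg (sub_pos.2 hθ.2) (sub_lt_self 1 hθ.1)⟩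
  have hprob : ∀ x, μ x * ((1 - θ) * s x + (Real.log (1 - θ) + θ * Real.log θ)) ≤
      μ x * (prob x * h x + Real.log θ) := fun x => by
    rcases (hμ.1 x).eq_or_lt with hx | hx
    · simp [← hx]
    have hge : 1 - θ ≤ prob x := sum_condProb_container_ge hμ.1 hp hθ.1.le hx
    have hle : prob x ≤ 1 := sum_condProb_container_le_one hμ.1 x
    have hs : 0 ≤ s x := containerEntropy_nonneg hp x
    refine mul_le_mul_of_nonneg_left ?_ hx.le
    simp only [h]
    nlinarith
  calc _ = ∑ x, μ x * ((1 - θ) * s x + (Real.log (1 - θ) + θ * Real.log θ)) := by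
        simp only [mul_add (μ _), sum_add_distrib, mul_left_comm (μ _) (1 - θ), ← mul_sum,
          ← sum_mul, hμ.2, one_mul, s]
    _ ≤ ∑ x, μ x * (prob x * h x + Real.log θ) := sum_le_sum fun x _ => hprob x
    _ = ∑ x, μ x * ((if x v ∈ container μ p θ F v x then 1 else 0) * h x + Real.log θ) := by
        simp only [mul_add (μ _), sum_add_distrib, sum_mul_mem_container_mul hμ.1 hh, prob]
    _ ≤ _ := sum_le_sum fun x _ => by
        rcases (hμ.1 x).eq_or_lt with hx | hx
        · simp [← hx]
        exact mul_le_mul_of_nonneg_left (log_containerDensity_ge hθ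
          (sum_container_pos hμ.1 hp hθ hac hx) (x v)) hx.le

theorem sum_mul_sum_containerEntropy_le (hμ : μ ∈ stdSimplex ℝ (V → K)) (hp : p ∈ stdSimplex ℝ K)
    (hθ : θ ∈ Set.Ioo 0 1) {W : ℝ} (hW : 0 < W) (hWμ : ∀ x, W * μ x ≤ ∏ v, p (x v)) :
    (1 - θ) * ∑ x, μ x * ∑ v, containerEntropy μ p θ F v x +
      Fintype.card V * (Real.log (1 - θ) + θ * Real.log θ) ≤ -Real.log W := by
  have hac : ∀ x, ∏ v, p (x v) = 0 → μ x = 0 := fun x hx =>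
    (hμ.1 x).antisymm' (nonpos_of_mul_nonpos_right ((hWμ x).trans_eq hx) hW)
  have herror : Real.log (1 - θ) + θ * Real.log θ ≤ 0 :=
    add_nonpos (Real.log_nonpos (sub_nonneg.2 hθ.2.le) (sub_le_self 1 hθ.1.le))
      (mul_nonpos_of_nonneg_of_nonpos hθ.1.le (Real.log_nonpos hθ.1.le hθ.2.le))
  refine le_trans ?_ (sum_mul_log_density_le hp (fun v => containerDensity_pos (v := v) hp hθ)
    (dependsOn_containerDensity μ p θ F)
    (fun v => sum_mul_containerDensity_le hp hθ.2.le) hμ hW hWμ)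
  refine le_trans ?_ (sum_le_sum fun v (_ : v ∈ Fᶜ) =>
    sum_mul_log_containerDensity_ge hμ hp hθ hac)
  rw [sum_add_distrib, ← mul_sum, sum_const, nsmul_eq_mul]
  refine add_le_add (le_of_eq ?_) (mul_le_mul_of_nonpos_right (mod_cast card_le_univ _) herror)
  rw [sum_comm]
  refine congrArg _ (sum_congr rfl fun x _ => ?_)
  rw [← mul_sum, ← sum_compl_add_sum F,
    sum_eq_zero (s := F) fun v hv => containerEntropy_of_mem hp hv x, add_zero]

variable {U : Type*} [Fintype U]

/-- Every box of colour patterns in which the patterns in `Q` have weight at most `κ` has entropy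
at least `m`. -/
def HitsLargeBoxes (p : K → ℝ) (Q : Finset (U → K)) (κ m : ℝ) : Prop :=
  ∀ A : U → Finset K, ∑ a ∈ Q with ∀ i, a i ∈ A i, ∏ i, p (a i) ≤ κ →
    ∏ i, ∑ b ∈ A i, p b ≤ Real.exp (-m)

variable {Q : Finset (U → K)} {κ m : ℝ}

theorem le_sum_containerEntropy (hμ : 0 ≤ μ) (hp : p ∈ stdSimplex ℝ K) (hθ : θ ∈ Set.Ioo 0 1)
    (hac : ∀ x, ∏ v, p (x v) = 0 → μ x = 0) (hQ : HitsLargeBoxes p Q κ m) {x : V → K}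
    (hx : 0 < μ x) (φ : U → V)
    (hφ : ∑ a ∈ Q with ∀ i, a i ∈ container μ p θ F (φ i) x, ∏ i, p (a i) ≤ κ) :
    m ≤ ∑ i, containerEntropy μ p θ F (φ i) x := by
  have hpos := fun i => sum_container_pos (F := F) (v := φ i) hμ hp hθ hac hx
  simp only [containerEntropy]
  rw [sum_neg_distrib, ← Real.log_prod fun i _ => (hpos i).ne', le_neg]
  exact (Real.log_le_iff_le_exp (prod_pos fun i _ => hpos i)).2 (hQ _ hφ)

theorem pow_mul_sum_le_sum_prod_condProb (hμ : 0 ≤ μ) (hp : 0 ≤ p) (hθ : 0 ≤ θ)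
    (Q : Finset (U → K)) {φ : U → V} (hφ : ∀ i, φ i ∉ F) (x : V → K) :
    θ ^ Fintype.card U * ∑ a ∈ Q with ∀ i, a i ∈ container μ p θ F (φ i) x, ∏ i, p (a i) ≤
      ∑ a ∈ Q, ∏ i, condProb μ F (φ i) (a i) x := by
  rw [mul_sum]
  refine (sum_le_sum fun a ha => ?_).trans (sum_le_sum_of_subset_of_nonneg (filter_subset _ Q)
    fun a _ _ => prod_nonneg fun i _ => condProb_nonneg hμ F _ _ x)
  rw [← card_univ, ← prod_const, ← prod_mul_distrib]
  exact prod_le_prod (fun i _ => mul_nonneg hθ (hp _)) fun i _ =>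
    (mem_container (hφ i)).1 ((mem_filter.1 ha).2 i)

/-- An embedding whose containers have small total entropy meets the pinned set, or its container
box contains a lot of `Q` and so the embedding has a colour pattern in `Q` with positive
probability. -/
theorem mul_one_sub_le_sum_containerEntropy (hμ : 0 ≤ μ) (hp : p ∈ stdSimplex ℝ K)
    (hθ : θ ∈ Set.Ioo 0 1) (hac : ∀ x, ∏ v, p (x v) = 0 → μ x = 0) (hκ : 0 < κ) (hm : 0 ≤ m)
    (hQ : HitsLargeBoxes p Q κ m) {x : V → K} (hx : 0 < μ x) (φ : U → V) :
    m * (1 - (∑ i, if φ i ∈ F then 1 else 0) - (κ * θ ^ Fintype.card U)⁻¹ *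
        ∑ a ∈ Q, ∏ i, condProb μ F (φ i) (a i) x) ≤
      ∑ i, containerEntropy μ p θ F (φ i) x := by
  have hκθ : 0 < κ * θ ^ Fintype.card U := mul_pos hκ (pow_pos hθ.1 _)
  set B := ∑ a ∈ Q, ∏ i, condProb μ F (φ i) (a i) x
  have hB : 0 ≤ (κ * θ ^ Fintype.card U)⁻¹ * B := mul_nonneg (inv_nonneg.2 hκθ.le)
    (sum_nonneg fun a _ => prod_nonneg fun i _ => condProb_nonneg hμ F _ _ x)
  have hentropy : 0 ≤ ∑ i, containerEntropy μ p θ F (φ i) x :=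
    sum_nonneg fun i _ => containerEntropy_nonneg hp x
  have hcount : (0 : ℝ) ≤ ∑ i, if φ i ∈ F then 1 else 0 :=
    sum_nonneg fun i _ => by split_ifs <;> norm_num
  by_cases hF : ∃ i, φ i ∈ F
  · obtain ⟨i, hi⟩ := hF
    have hcount : (1 : ℝ) ≤ ∑ i, if φ i ∈ F then 1 else 0 := by
      rw [sum_boole]
      exact_mod_cast card_pos.2 ⟨i, mem_filter.2 ⟨mem_univ i, hi⟩⟩
    exact (mul_nonpos_of_nonneg_of_nonpos hm (by linarith)).trans hentropy
  push Not at hF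
  by_cases hφ : ∑ a ∈ Q with ∀ i, a i ∈ container μ p θ F (φ i) x, ∏ i, p (a i) ≤ κ
  · exact (mul_le_of_le_one_right hm (by linarith)).trans
      (le_sum_containerEntropy hμ hp hθ hac hQ hx φ hφ)
  · have hκB : κ * θ ^ Fintype.card U ≤ B :=
      calc κ * θ ^ Fintype.card U = θ ^ Fintype.card U * κ := mul_comm _ _
        _ ≤ θ ^ Fintype.card U *
            ∑ a ∈ Q with ∀ i, a i ∈ container μ p θ F (φ i) x, ∏ i, p (a i) :=
          mul_le_mul_of_nonneg_left (not_le.1 hφ).le (pow_nonneg hθ.1.le _)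
        _ ≤ B := pow_mul_sum_le_sum_prod_condProb hμ hp.1 hθ.1.le Q hF x
    have : 1 ≤ (κ * θ ^ Fintype.card U)⁻¹ * B := by
      rwa [inv_mul_eq_div, one_le_div hκθ]
    exact (mul_nonpos_of_nonneg_of_nonpos hm (by linarith)).trans hentropy

theorem mul_card_sub_le_sum_containerEntropy (hμ : 0 ≤ μ) (hp : p ∈ stdSimplex ℝ K)
    (hθ : θ ∈ Set.Ioo 0 1) (hac : ∀ x, ∏ v, p (x v) = 0 → μ x = 0) {E : Finset (U ↪ V)} {k : ℕ}
    (hE : IsRegularFamily E k) (hκ : 0 < κ) (hm : 0 ≤ m) (hQ : HitsLargeBoxes p Q κ m)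
    {x : V → K} (hx : 0 < μ x) :
    m * (#E - k * #F - (κ * θ ^ Fintype.card U)⁻¹ *
        ∑ φ ∈ E, ∑ a ∈ Q, ∏ i, condProb μ F (φ i) (a i) x) ≤
      k * ∑ v, containerEntropy μ p θ F v x := by
  have hpinned : ∑ φ ∈ E, ∑ i, (if φ i ∈ F then 1 else 0 : ℝ) = k * #F := by
    rw [hE.sum_sum_apply_eq fun v => if v ∈ F then (1 : ℝ) else 0]
    simp
  rw [← nsmul_eq_mul k (∑ v, _), ← hE.sum_sum_apply_eq]
  refine le_trans (le_of_eq ?_) (sum_le_sum fun φ _ =>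
    mul_one_sub_le_sum_containerEntropy hμ hp hθ hac hκ hm hQ hx φ)
  rw [← mul_sum, sum_sub_distrib, sum_sub_distrib, hpinned, ← mul_sum]
  simp

theorem mul_card_sub_le_sum_mul_sum_containerEntropy (hμ : μ ∈ stdSimplex ℝ (V → K))
    (hp : p ∈ stdSimplex ℝ K) (hθ : θ ∈ Set.Ioo 0 1) (hac : ∀ x, ∏ v, p (x v) = 0 → μ x = 0)
    {E : Finset (U ↪ V)} {k : ℕ} (hE : IsRegularFamily E k) (hκ : 0 < κ) (hm : 0 ≤ m)
    (hQ : HitsLargeBoxes p Q κ m) :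
    m * (#E - k * #F - (κ * θ ^ Fintype.card U)⁻¹ *
        ∑ φ ∈ E, ∑ x, μ x * ∑ a ∈ Q, ∏ i, condProb μ F (φ i) (a i) x) ≤
      k * ∑ x, μ x * ∑ v, containerEntropy μ p θ F v x := by
  have hpoint : ∀ x, μ x * (m * (#E - k * #F - (κ * θ ^ Fintype.card U)⁻¹ *
      ∑ φ ∈ E, ∑ a ∈ Q, ∏ i, condProb μ F (φ i) (a i) x)) ≤
      μ x * (k * ∑ v, containerEntropy μ p θ F v x) := fun x => by
    rcases (hμ.1 x).eq_or_lt with hx | hx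
    · simp [← hx]
    · exact mul_le_mul_of_nonneg_left
        (mul_card_sub_le_sum_containerEntropy hμ.1 hp hθ hac hE hκ hm hQ hx) hx.le
  have hsum := sum_le_sum fun x (_ : x ∈ univ) => hpoint x
  simp only [mul_left_comm (μ _), ← mul_sum, mul_sub (μ _), sum_sub_distrib, ← sum_mul, hμ.2,
    one_mul] at hsum
  rw [sum_comm]
  simpa only [← mul_sum] using hsum

end Containers

section FiniteBound

open Finset

theorem exists_pos_forall_card_mul_le_neg_log (U K : Type*) [Fintype U] [Nonempty U]
    [Fintype K] [DecidableEq K] {θ κ : ℝ} (hθ : θ ∈ Set.Ioo 0 1) (hκ : 0 < κ) :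
    ∃ σ : ℝ, 0 < σ ∧ ∀ (V : Type u) [Fintype V] [DecidableEq V] (E : Finset (U ↪ V)) (k : ℕ),
      0 < k → IsRegularFamily E k → IsSpread E σ → ∀ μ ∈ stdSimplex ℝ (V → K),
      ∀ p ∈ stdSimplex ℝ K, ∀ W : ℝ, 0 < W → (∀ x, W * μ x ≤ ∏ v, p (x v)) →
      ∀ (Q : Finset (U → K)) (m : ℝ), 0 ≤ m → HitsLargeBoxes p Q κ m →
      ∑ φ ∈ E, ∑ x with x ∘ φ ∈ Q, μ x ≤ κ * θ ^ Fintype.card U * (θ / 3) * #E →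
      Fintype.card V * ((1 - θ) ^ 2 * (m / Fintype.card U) +
        (Real.log (1 - θ) + θ * Real.log θ)) ≤ -Real.log W := by
  classical
  have hθ0 := hθ.1
  have hr : (0 : ℝ) < Fintype.card U := mod_cast Fintype.card_pos
  have hκθ : 0 < κ * θ ^ Fintype.card U := by positivity
  set κθ := κ * θ ^ Fintype.card U
  obtain ⟨σ, hσ, hpin⟩ := exists_pinning_set_condProb.{u} K U
    (C := 3 * Fintype.card U / θ) (by positivity) (τ := κθ * (θ / 3)) (by positivity)
  refine ⟨σ, hσ, fun V _ _ E k hk hE hspread μ hμ p hp W hW hWμ Q m hm hQ hfew => ?_⟩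
  obtain ⟨F, hF, hnear⟩ := hpin V E k hE hspread μ hμ Q
  have hac : ∀ x, ∏ v, p (x v) = 0 → μ x = 0 := fun x hx =>
    (hμ.1 x).antisymm' (nonpos_of_mul_nonpos_right ((hWμ x).trans_eq hx) hW)
  have hk' : (0 : ℝ) < k := mod_cast hk
  have hcard : (Fintype.card U : ℝ) * #E = k * Fintype.card V := mod_cast hE.card_mul_card_eq
  have hentropy := mul_card_sub_le_sum_mul_sum_containerEntropy (F := F) hμ hp hθ hac hE hκ hm hQ
  set S := ∑ x, μ x * ∑ v, containerEntropy μ p θ F v x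
  have hpinned : k * #F ≤ θ / 3 * (#E : ℝ) := by
    rw [div_mul_eq_mul_div, div_le_iff₀ hθ0] at hF
    refine le_of_mul_le_mul_left ?_ hr
    linear_combination (k / 3 : ℝ) * hF - θ / 3 * hcard
  have hcoloured : κθ⁻¹ * ∑ φ ∈ E, ∑ x, μ x * ∑ a ∈ Q, ∏ i, condProb μ F (φ i) (a i) x ≤
      2 * θ / 3 * #E := by
    rw [inv_mul_le_iff₀ hκθ]
    linarith
  have hS : (1 - θ) * (m / Fintype.card U) * Fintype.card V ≤ S := by
    refine le_of_mul_le_mul_left (hentropy.trans' ?_) hk'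
    calc k * ((1 - θ) * (m / Fintype.card U) * Fintype.card V)
        = m * ((1 - θ) * (k * Fintype.card V / Fintype.card U)) := by ring
      _ = m * ((1 - θ) * #E) := by rw [← hcard, mul_div_cancel_left₀ _ hr.ne']
      _ ≤ _ := mul_le_mul_of_nonneg_left (by linarith) hm
  have hGibbs := sum_mul_sum_containerEntropy_le (F := F) hμ hp hθ hW hWμ
  have := mul_le_mul_of_nonneg_left hS (sub_nonneg.2 hθ.2.le)
  linarith

end FiniteBound

section ExponentialMoments

open scoped ENNReal ProbabilityTheory
open Finset

theorem integral_cond_le_of_lintegral_exp_le {Ω : Type*} [MeasurableSpace Ω] {m : Measure Ω}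
    [IsFiniteMeasure m] {S : Set Ω} (hS : 0 < m.real S) {h : Ω → ℝ} (hh : Integrable h m) {y : ℝ}
    (hy : ∫⁻ x, ENNReal.ofReal (Real.exp (h x)) ∂m ≤ ENNReal.ofReal (Real.exp y)) :
    ∫ x, h x ∂m[|S] ≤ y - Real.log (m.real S) := by
  have hpos : ∀ (ν : Measure Ω), 0 ≤ᵐ[ν] fun x => Real.exp (h x) := fun ν =>
    ae_of_all _ fun x => (Real.exp_pos _).le
  have hexp : Integrable (fun x => Real.exp (h x)) m :=
    ⟨Real.continuous_exp.comp_aestronglyMeasurable hh.1,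
      (hasFiniteIntegral_iff_ofReal (hpos m)).2 (hy.trans_lt ENNReal.ofReal_lt_top)⟩
  have hle : ∫ x, Real.exp (h x) ∂m ≤ Real.exp y := by
    rw [integral_eq_lintegral_of_nonneg_ae (hpos m) hexp.1]
    exact ENNReal.toReal_le_of_le_ofReal (Real.exp_pos y).le hy
  have hmS : m S ≠ 0 := fun h0 => hS.ne' (by simp [measureReal_def, h0])
  have : IsProbabilityMeasure m[|S] := ProbabilityTheory.cond_isProbabilityMeasure hmS
  have hcond : ∀ f : Ω → ℝ, Integrable f m → Integrable f m[|S] := fun f hf =>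
    hf.restrict.smul_measure (ENNReal.inv_ne_top.2 hmS)
  have hjensen := convexOn_exp.map_integral_le Real.continuous_exp.continuousOn isClosed_univ
    (ae_of_all _ fun x => Set.mem_univ (h x)) (hcond h hh) (hcond _ hexp)
  have hrestrict : ∫ x, Real.exp (h x) ∂m[|S] ≤ Real.exp y / m.real S := by
    rw [ProbabilityTheory.cond, integral_smul_measure, ENNReal.toReal_inv, smul_eq_mul,
      inv_mul_eq_div]
    exact div_le_div_of_nonneg_right ((setIntegral_le_integral hexp (hpos m)).trans hle) hS.le
  have hlog := (Real.le_log_iff_exp_le (div_pos (Real.exp_pos y) hS)).2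
    (hjensen.trans hrestrict)
  rwa [Real.log_div (Real.exp_pos y).ne' hS.ne', Real.log_exp] at hlog

variable {U V X : Type*} [Fintype U] [Fintype V] [MeasurableSpace X] {μ : Measure X}
  [IsProbabilityMeasure μ]

theorem measurePreserving_comp_embedding (μ : Measure X) [IsProbabilityMeasure μ] (φ : U ↪ V) :
    MeasurePreserving (fun c : V → X => c ∘ φ) (Measure.pi fun _ => μ)
      (Measure.pi fun _ => μ) := by
  have hmeas : ∀ i, Measurable fun c : V → X => c (φ i) := fun i => measurable_pi_apply (φ i)
  have hind : ProbabilityTheory.iIndepFun (fun (v : V) (c : V → X) => c v)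
      (Measure.pi fun _ => μ) :=
    ProbabilityTheory.iIndepFun_pi (X := fun _ => id) fun _ => aemeasurable_id
  refine ⟨measurable_pi_iff.2 hmeas, ((ProbabilityTheory.iIndepFun_iff_map_fun_eq_pi_map
    fun i => (hmeas i).aemeasurable).1 (hind.precomp φ.injective)).trans ?_⟩
  exact congrArg Measure.pi (funext fun i => (measurePreserving_eval (fun _ => μ) (φ i)).map_eq)

theorem IsRegularFamily.lintegral_prod_comp_rpow_le [DecidableEq V] {E : Finset (U ↪ V)} {k : ℕ}
    (hE : IsRegularFamily E k) (hk : 0 < k) {f : (U → X) → ℝ≥0∞} (hf : Measurable f) :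
    ∫⁻ c, ∏ φ ∈ E, f (c ∘ φ) ^ (k : ℝ)⁻¹ ∂(Measure.pi fun _ : V => μ) ≤
      (∫⁻ y, f y ∂(Measure.pi fun _ : U => μ)) ^ (#E / k : ℝ) := by
  have hk' : (k : ℝ) ≠ 0 := mod_cast hk.ne'
  refine (lintegral_prod_rpow_le_of_cover E (S := fun φ => univ.map φ)
    (f := fun φ c => f (c ∘ φ))
    (fun φ => hf.comp (measurePreserving_comp_embedding μ φ).measurable)
    (fun φ x y hxy => congrArg f (funext fun i => hxy (φ i) (by simp)))
    (p := fun _ => (k : ℝ)⁻¹) (fun _ => by positivity) fun v => ?_).trans_eq ?_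
  · rw [sum_const, hE v, nsmul_eq_mul, mul_inv_cancel₀ hk']
  · simp only [(measurePreserving_comp_embedding μ _).lintegral_comp hf, prod_const]
    rw [← ENNReal.rpow_mul_natCast, inv_mul_eq_div]

theorem lintegral_exp_indicator_le {Ω : Type*} [MeasurableSpace Ω] (m : Measure Ω)
    [IsProbabilityMeasure m] {B : Set Ω} (hB : MeasurableSet B) (l : ℝ) :
    ∫⁻ x, ENNReal.ofReal (Real.exp (B.indicator (fun _ => l) x)) ∂m ≤
      ENNReal.ofReal (Real.exp (Real.exp l * m.real B)) := by
  have hpoint : ∀ x, ENNReal.ofReal (Real.exp (B.indicator (fun _ => l) x)) ≤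
      1 + B.indicator (fun _ => ENNReal.ofReal (Real.exp l)) x := fun x => by
    by_cases hx : x ∈ B <;> simp [hx]
  calc ∫⁻ x, ENNReal.ofReal (Real.exp (B.indicator (fun _ => l) x)) ∂m
      ≤ ∫⁻ x, (1 + B.indicator (fun _ => ENNReal.ofReal (Real.exp l)) x) ∂m :=
        lintegral_mono hpoint
    _ = ENNReal.ofReal (Real.exp l * m.real B + 1) := by
        rw [lintegral_add_left measurable_const, lintegral_indicator_const hB, lintegral_one,
          measure_univ, add_comm, ENNReal.ofReal_add (by positivity) zero_le_one,
          ENNReal.ofReal_mul (Real.exp_pos l).le, ofReal_measureReal, ENNReal.ofReal_one]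
    _ ≤ _ := ENNReal.ofReal_le_ofReal (Real.add_one_le_exp _)

theorem IsRegularFamily.lintegral_exp_sum_indicator_le [DecidableEq V] {E : Finset (U ↪ V)} {k : ℕ}
    (hE : IsRegularFamily E k) (hk : 0 < k) {B : Set (U → X)} (hB : MeasurableSet B) (l : ℝ) :
    ∫⁻ c, ENNReal.ofReal (Real.exp ((∑ φ ∈ E, B.indicator (fun _ => l) (c ∘ φ)) / k))
        ∂(Measure.pi fun _ : V => μ) ≤
      ENNReal.ofReal (Real.exp (Real.exp l * (Measure.pi fun _ : U => μ).real B * (#E / k))) := by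
  let f : (U → X) → ℝ≥0∞ := fun y => ENNReal.ofReal (Real.exp (B.indicator (fun _ => l) y))
  have hf : Measurable f := (measurable_const.indicator hB).exp.ennreal_ofReal
  have hprod : ∀ c : V → X,
      ENNReal.ofReal (Real.exp ((∑ φ ∈ E, B.indicator (fun _ => l) (c ∘ φ)) / k)) =
        ∏ φ ∈ E, f (c ∘ φ) ^ (k : ℝ)⁻¹ := fun c => by
    rw [sum_div, Real.exp_sum, ENNReal.ofReal_prod_of_nonneg fun φ _ => (Real.exp_pos _).le]
    refine prod_congr rfl fun φ _ => ?_
    rw [ENNReal.ofReal_rpow_of_pos (Real.exp_pos _), ← Real.exp_mul, div_eq_mul_inv]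
  simp only [hprod]
  refine (hE.lintegral_prod_comp_rpow_le hk hf).trans ?_
  rw [Real.exp_mul, ← ENNReal.ofReal_rpow_of_pos (Real.exp_pos _)]
  exact ENNReal.rpow_le_rpow (lintegral_exp_indicator_le _ hB l) (by positivity)

theorem IsRegularFamily.mul_sum_cond_real_le [DecidableEq V] {E : Finset (U ↪ V)} {k : ℕ}
    (hE : IsRegularFamily E k) (hk : 0 < k) {B : Set (U → X)} (hB : MeasurableSet B) (l : ℝ)
    {S : Set (V → X)} (hS : 0 < (Measure.pi fun _ : V => μ).real S) :
    l * ∑ φ ∈ E, (Measure.pi fun _ : V => μ)[|S].real {c | c ∘ φ ∈ B} ≤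
      Real.exp l * (Measure.pi fun _ : U => μ).real B * #E -
        k * Real.log ((Measure.pi fun _ : V => μ).real S) := by
  have hk' : (0 : ℝ) < k := mod_cast hk
  have hBφ : ∀ φ : U ↪ V, MeasurableSet {c : V → X | c ∘ φ ∈ B} := fun φ =>
    (measurePreserving_comp_embedding μ φ).measurable hB
  have hind : ∀ (φ : U ↪ V) (c : V → X),
      B.indicator (fun _ => l) (c ∘ φ) = {c | c ∘ φ ∈ B}.indicator (fun _ => l) c := fun _ _ => rfl
  have hint : ∀ (ν : Measure (V → X)) [IsFiniteMeasure ν] (φ : U ↪ V),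
      Integrable (fun c => B.indicator (fun _ => l) (c ∘ φ)) ν := fun ν _ φ =>
    (integrable_const l).indicator (hBφ φ)
  have hcond := integral_cond_le_of_lintegral_exp_le hS
    ((integrable_finsetSum E fun φ _ => hint _ φ).div_const _)
    (hE.lintegral_exp_sum_indicator_le hk hB l)
  rw [integral_div, integral_finsetSum _ fun φ _ => hint _ φ, div_le_iff₀ hk'] at hcond
  simp only [hind, integral_indicator_const _ (hBφ _), smul_eq_mul, ← sum_mul] at hcond
  refine (hcond.trans_eq' (mul_comm _ _)).trans_eq ?_
  field_simp

end ExponentialMoments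

section ColourLaws

open scoped ENNReal ProbabilityTheory symmDiff
open Finset

theorem comp_preimage_singleton {V X K : Type*} (q : X → K) (x : V → K) :
    (q ∘ ·) ⁻¹' {x} = Set.univ.pi fun v => q ⁻¹' {x v} := by
  ext c
  simp [funext_iff]

variable {X K : Type*} [MeasurableSpace X] {q : X → K}

theorem measureReal_preimage_singleton_mem_stdSimplex [Fintype K] (μ : Measure X)
    [IsProbabilityMeasure μ] (hq : ∀ a, MeasurableSet (q ⁻¹' {a})) :
    (fun a => μ.real (q ⁻¹' {a})) ∈ stdSimplex ℝ K :=
  ⟨fun _ => measureReal_nonneg,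
    by simpa using sum_measureReal_preimage_singleton (μ := μ) univ fun a _ => hq a⟩

theorem measurableSet_comp_preimage_singleton {V : Type*} [Countable V]
    (hq : ∀ a, MeasurableSet (q ⁻¹' {a})) (x : V → K) :
    MeasurableSet ((q ∘ ·) ⁻¹' {x}) := by
  rw [comp_preimage_singleton]
  exact MeasurableSet.univ_pi fun v => hq (x v)

variable {μ : Measure X} [IsProbabilityMeasure μ]

theorem measureReal_comp_preimage_singleton {V : Type*} [Fintype V] (q : X → K) (x : V → K) :
    (Measure.pi fun _ => μ).real ((q ∘ ·) ⁻¹' {x}) = ∏ v, μ.real (q ⁻¹' {x v}) := by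
  simp only [comp_preimage_singleton, measureReal_def, Measure.pi_pi, ENNReal.toReal_prod]

theorem measureReal_mul_cond_real_le {V : Type*} [Fintype V]
    (hq : ∀ a, MeasurableSet (q ⁻¹' {a})) (S : Set (V → X)) (x : V → K) :
    (Measure.pi fun _ => μ).real S * (Measure.pi fun _ => μ)[|S].real ((q ∘ ·) ⁻¹' {x}) ≤
      ∏ v, μ.real (q ⁻¹' {x v}) := by
  rw [measureReal_def (_[|S]),
    ProbabilityTheory.cond_apply' (measurableSet_comp_preimage_singleton hq x),
    ENNReal.toReal_mul, ENNReal.toReal_inv, ← mul_assoc, ← measureReal_comp_preimage_singleton]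
  exact (mul_le_of_le_one_left ENNReal.toReal_nonneg mul_inv_le_one).trans
    (measureReal_mono Set.inter_subset_right)

variable {U : Type*} [Fintype U] {P : Set (U → X)} {Q : Finset (U → K)}

theorem hitsLargeBoxes_measureReal_preimage [DecidableEq K] {κ m : ℝ}
    (hbox : ∀ A : U → Set X, (∀ i, MeasurableSet (A i)) →
      Measure.pi (fun _ => μ) (Set.univ.pi A \ P) ≤ ENNReal.ofReal κ →
      Measure.pi (fun _ => μ) (Set.univ.pi A) < ENNReal.ofReal (Real.exp (-m)))
    (hq : ∀ a, MeasurableSet (q ⁻¹' {a}))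
    (hQ : (Measure.pi fun _ => μ).real ({c | q ∘ c ∈ Q} ∆ Pᶜ) ≤ κ / 2) :
    HitsLargeBoxes (fun a => μ.real (q ⁻¹' {a})) Q (κ / 2) m := by
  intro A hA
  have hqA : ∀ i, MeasurableSet (q ⁻¹' (A i)) := fun i => by
    rw [← Set.biUnion_preimage_singleton]
    exact (A i).measurableSet_biUnion fun a _ => hq a
  set QA := {a ∈ Q | ∀ i, a i ∈ A i}
  have hsubset : Set.univ.pi (fun i => q ⁻¹' (A i)) \ P ⊆
      (q ∘ ·) ⁻¹' (QA : Set (U → K)) ∪ {c | q ∘ c ∈ Q} ∆ Pᶜ := by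
    rintro c ⟨hc, hcP⟩
    by_cases hcQ : q ∘ c ∈ Q
    · exact Or.inl (mem_filter.2 ⟨hcQ, fun i => hc i (Set.mem_univ i)⟩)
    · exact Or.inr (Or.inr ⟨hcP, hcQ⟩)
  have hQA : (Measure.pi fun _ => μ).real ((q ∘ ·) ⁻¹' (QA : Set (U → K))) ≤ κ / 2 := by
    rw [← sum_measureReal_preimage_singleton _ fun a _ =>
      measurableSet_comp_preimage_singleton hq a]
    simpa only [measureReal_comp_preimage_singleton] using hA
  have hdiff : (Measure.pi fun _ => μ).real (Set.univ.pi (fun i => q ⁻¹' (A i)) \ P) ≤ κ :=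
    (measureReal_mono hsubset).trans ((measureReal_union_le _ _).trans (by linarith))
  have hvol := hbox _ hqA ((ENNReal.le_ofReal_iff_toReal_le (measure_ne_top _ _)
    (measureReal_nonneg.trans hdiff)).2 hdiff)
  have hfibres : ∀ i, ∑ a ∈ A i, μ.real (q ⁻¹' {a}) = (μ (q ⁻¹' (A i))).toReal := fun i =>
    sum_measureReal_preimage_singleton (A i) fun a _ => hq a
  simp only [hfibres, ← ENNReal.toReal_prod, ← Measure.pi_pi]
  exact ENNReal.toReal_le_of_le_ofReal (Real.exp_pos _).le hvol.le

theorem IsRegularFamily.mul_sum_sum_cond_real_le [Fintype K] [DecidableEq K]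
    {V : Type*} [Fintype V] [DecidableEq V] {E : Finset (U ↪ V)} {k : ℕ}
    (hE : IsRegularFamily E k) (hk : 0 < k)
    (hq : ∀ a, MeasurableSet (q ⁻¹' {a})) {S : Set (V → X)} (hSP : ∀ c ∈ S, ∀ φ ∈ E, c ∘ φ ∈ P)
    (hS : 0 < (Measure.pi fun _ => μ).real S)
    (hP : NullMeasurableSet P (Measure.pi fun _ => μ)) {l : ℝ} (hl : 0 ≤ l) :
    l * ∑ φ ∈ E, ∑ x with x ∘ φ ∈ Q, (Measure.pi fun _ => μ)[|S].real ((q ∘ ·) ⁻¹' {x}) ≤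
      Real.exp l * (Measure.pi fun _ => μ).real ({c | q ∘ c ∈ Q} ∆ Pᶜ) * #E -
        k * Real.log ((Measure.pi fun _ => μ).real S) := by
  obtain ⟨P', hPP', hP', hae⟩ := hP.exists_measurable_superset_ae_eq
  set B : Set (U → X) := {c | q ∘ c ∈ Q} ∩ P'
  have hQmeas : MeasurableSet {c : U → X | q ∘ c ∈ Q} :=
    measurableSet_setOf_comp_mem hq (Q : Set (U → K))
  have hB : MeasurableSet B := hQmeas.inter hP'
  have hBQ : (Measure.pi fun _ => μ).real B ≤
      (Measure.pi fun _ => μ).real ({c | q ∘ c ∈ Q} ∆ Pᶜ) := by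
    rw [measureReal_congr ((ae_eq_refl _).inter hae)]
    exact measureReal_mono fun c hc => Or.inl ⟨hc.1, fun h => h hc.2⟩
  have hedge : ∀ φ ∈ E, ∑ x with x ∘ φ ∈ Q, (Measure.pi fun _ => μ)[|S].real ((q ∘ ·) ⁻¹' {x}) ≤
      (Measure.pi fun _ => μ)[|S].real {c | c ∘ φ ∈ B} := fun φ hφ => by
    have hpattern : MeasurableSet {c : V → X | q ∘ c ∘ φ ∈ Q} :=
      (measurePreserving_comp_embedding μ φ).measurable hQmeas
    have hedgeB : MeasurableSet {c : V → X | c ∘ φ ∈ B} :=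
      (measurePreserving_comp_embedding μ φ).measurable hB
    have hpreimage : (q ∘ ·) ⁻¹' ({x : V → K | x ∘ φ ∈ Q}) = {c : V → X | q ∘ c ∘ φ ∈ Q} := rfl
    rw [sum_measureReal_preimage_singleton _ fun x _ => measurableSet_comp_preimage_singleton hq x,
      coe_filter_univ, hpreimage]
    refine ENNReal.toReal_mono (measure_ne_top _ _) ?_
    rw [ProbabilityTheory.cond_apply' hpattern, ProbabilityTheory.cond_apply' hedgeB]
    gcongr _ * (Measure.pi fun _ => μ) ?_
    exact fun c hc => ⟨hc.1, hc.2, hPP' (hSP c hc.1 φ hφ)⟩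
  refine (mul_le_mul_of_nonneg_left (sum_le_sum hedge) hl).trans
    ((hE.mul_sum_cond_real_le hk hB l hS).trans ?_)
  gcongr

end ColourLaws

section VolumeBound

open scoped ENNReal ProbabilityTheory symmDiff
open Finset

theorem exists_sub_le_one_sub_sq_mul_add (c : ℝ) {η : ℝ} (hη : 0 < η) :
    ∃ θ ∈ Set.Ioo (0 : ℝ) 1,
      c - η ≤ (1 - θ) ^ 2 * c + (Real.log (1 - θ) + θ * Real.log θ) := by
  have hcont : ContinuousAt
      (fun θ : ℝ => (1 - θ) ^ 2 * c + (Real.log (1 - θ) + θ * Real.log θ)) 0 := by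
    refine ContinuousAt.add (by fun_prop) (ContinuousAt.add ?_ Real.continuous_mul_log.continuousAt)
    exact ContinuousAt.log (by fun_prop) (by norm_num)
  have hzero : c - η < (1 - (0 : ℝ)) ^ 2 * c + (Real.log (1 - 0) + 0 * Real.log 0) := by
    simp [hη]
  have hnear : ∀ᶠ θ in 𝓝[>] (0 : ℝ),
      c - η < (1 - θ) ^ 2 * c + (Real.log (1 - θ) + θ * Real.log θ) :=
    (hcont.eventually_const_lt hzero).filter_mono nhdsWithin_le_nhds
  obtain ⟨θ, hθ, hθmem⟩ := (hnear.and (Ioo_mem_nhdsGT zero_lt_one)).exists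
  exact ⟨θ, hθmem, hθ.le⟩

variable {U X : Type*} [Fintype U] [MeasurableSpace X] {μ : Measure X} [IsProbabilityMeasure μ]
  {P : Set (U → X)}

theorem IsRegularFamily.sum_sum_cond_real_le {K V : Type*} [Fintype K] [DecidableEq K]
    {q : X → K} {Q : Finset (U → K)} [Fintype V] [DecidableEq V] {E : Finset (U ↪ V)} {k : ℕ}
    (hE : IsRegularFamily E k) (hk : 0 < k) (hq : ∀ a, MeasurableSet (q ⁻¹' {a}))
    {S : Set (V → X)} (hSP : ∀ c ∈ S, ∀ φ ∈ E, c ∘ φ ∈ P)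
    (hP : NullMeasurableSet P (Measure.pi fun _ => μ)) [Nonempty U] {m γ : ℝ} (hm : 0 ≤ m)
    (hγ : 0 < γ)
    (hQ : (Measure.pi fun _ => μ).real ({c | q ∘ c ∈ Q} ∆ Pᶜ) ≤ Real.exp (-((m + 1) / γ)))
    (hS : Real.exp (-(m / Fintype.card U * Fintype.card V)) ≤ (Measure.pi fun _ => μ).real S) :
    ∑ φ ∈ E, ∑ x with x ∘ φ ∈ Q, (Measure.pi fun _ => μ)[|S].real ((q ∘ ·) ⁻¹' {x}) ≤
      γ * #E := by
  set l := (m + 1) / γ with hl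
  have hl_pos : 0 < l := by positivity
  have hS_pos := (Real.exp_pos _).trans_le hS
  have hlog : -Real.log ((Measure.pi fun _ => μ).real S) ≤
      m / Fintype.card U * Fintype.card V :=
    neg_le.1 ((Real.le_log_iff_exp_le hS_pos).2 hS)
  have hcard : (Fintype.card U * #E : ℝ) = k * Fintype.card V := mod_cast hE.card_mul_card_eq
  have hU : (Fintype.card U : ℝ) ≠ 0 := mod_cast Fintype.card_ne_zero
  refine le_of_mul_le_mul_left ?_ hl_pos
  calc l * ∑ φ ∈ E, ∑ x with x ∘ φ ∈ Q, (Measure.pi fun _ => μ)[|S].real ((q ∘ ·) ⁻¹' {x})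
      ≤ Real.exp l * (Measure.pi fun _ => μ).real ({c | q ∘ c ∈ Q} ∆ Pᶜ) * #E -
          k * Real.log ((Measure.pi fun _ => μ).real S) :=
        hE.mul_sum_sum_cond_real_le hk hq hSP hS_pos hP hl_pos.le
    _ = Real.exp l * (Measure.pi fun _ => μ).real ({c | q ∘ c ∈ Q} ∆ Pᶜ) * #E +
          k * -Real.log ((Measure.pi fun _ => μ).real S) := by ring
    _ ≤ Real.exp l * Real.exp (-l) * #E + k * (m / Fintype.card U * Fintype.card V) := by gcongr
    _ = #E + m / Fintype.card U * (k * Fintype.card V) := by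
        rw [← Real.exp_add, add_neg_cancel, Real.exp_zero]; ring
    _ = l * (γ * #E) := by rw [← hcard, hl]; field_simp; ring

theorem exists_pos_forall_measureReal_le [Nonempty U]
    (hP : NullMeasurableSet P (Measure.pi fun _ => μ)) {m η : ℝ} (hm : 0 ≤ m) (hη : 0 < η)
    (hbox : ∀ A : U → Set X, (∀ i, MeasurableSet (A i)) →
      Measure.pi (fun _ => μ) (Set.univ.pi A \ P) = 0 →
      Measure.pi (fun _ => μ) (Set.univ.pi A) < ENNReal.ofReal (Real.exp (-m))) :
    ∃ σ : ℝ, 0 < σ ∧ ∀ (V : Type u) [Fintype V] [DecidableEq V] (E : Finset (U ↪ V)) (k : ℕ),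
      0 < k → IsRegularFamily E k → IsSpread E σ →
      ∀ S : Set (V → X), (∀ c ∈ S, ∀ φ ∈ E, c ∘ φ ∈ P) →
      (Measure.pi fun _ => μ).real S ≤
        Real.exp (-((m / Fintype.card U - η) * Fintype.card V)) := by
  classical
  obtain ⟨κ, hκ, hboxκ⟩ := exists_pos_forall_box_lt hP hbox
  obtain ⟨θ, hθ, hθη⟩ := exists_sub_le_one_sub_sq_mul_add (m / Fintype.card U) hη
  set γ := κ / 2 * θ ^ Fintype.card U * (θ / 3)
  have hγ : 0 < γ := by have := hθ.1; positivity
  obtain ⟨K, _, q, Q', hq, hQ'⟩ := exists_colouring_measure_symmDiff_lt _ hP.compl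
    (ENNReal.ofReal_pos.2 (lt_min (half_pos hκ) (Real.exp_pos (-((m + 1) / γ)))))
  obtain ⟨Q, rfl⟩ := Q'.toFinite.exists_finset_coe
  have hQ := ENNReal.toReal_le_of_le_ofReal
    (lt_min (half_pos hκ) (Real.exp_pos (-((m + 1) / γ)))).le hQ'.le
  obtain ⟨σ, hσ, hcontainers⟩ := exists_pos_forall_card_mul_le_neg_log.{u} U K hθ (half_pos hκ)
  refine ⟨σ, hσ, fun V _ _ E k hk hE hspread S hSP => ?_⟩
  obtain hsmall | hlarge := le_total ((Measure.pi fun _ => μ).real S)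
    (Real.exp (-(m / Fintype.card U * Fintype.card V)))
  · refine hsmall.trans (Real.exp_le_exp.2 (neg_le_neg ?_))
    gcongr
    exact sub_le_self _ hη.le
  have hS := (Real.exp_pos _).trans_le hlarge
  have := ProbabilityTheory.cond_isProbabilityMeasure (ENNReal.toReal_pos_iff.1 hS).1.ne'
  have hentropy := hcontainers V E k hk hE hspread _
    (measureReal_preimage_singleton_mem_stdSimplex ((Measure.pi fun _ => μ)[|S])
      (measurableSet_comp_preimage_singleton hq)) _
    (measureReal_preimage_singleton_mem_stdSimplex μ hq) _ hS
    (measureReal_mul_cond_real_le hq S) Q m hm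
    (hitsLargeBoxes_measureReal_preimage (fun A _ => hboxκ A) hq (hQ.trans (min_le_left _ _)))
    (hE.sum_sum_cond_real_le hk hq hSP hP hm hγ (hQ.trans (min_le_right _ _)) hlarge)
  rw [← Real.log_le_iff_le_exp hS, le_neg]
  refine hentropy.trans' ?_
  rw [mul_comm]
  gcongr

end VolumeBound

theorem exists_tendsto_of_forall_lt_eventually_le {ι R : Type*} [CompleteLinearOrder R]
    [DenselyOrdered R] [TopologicalSpace R] [OrderTopology R] {l : Filter ι} {a b : ι → R}
    (hba : ∀ᶠ n in l, b n ≤ a n) (hab : ∀ᶠ N in l, ∀ c < a N, ∀ᶠ n in l, c ≤ b n) :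
    ∃ L, Tendsto a l (𝓝 L) ∧ Tendsto b l (𝓝 L) := by
  have hlim : limsup a l ≤ liminf b l := by
    refine le_of_forall_lt_imp_le_of_dense fun c hc => ?_
    obtain ⟨N, hcN, hN⟩ := ((frequently_lt_of_lt_limsup (by isBoundedDefault) hc).and_eventually
      hab).exists
    exact le_liminf_of_le (by isBoundedDefault) (hN c hcN)
  exact ⟨limsup a l,
    tendsto_of_le_liminf_of_limsup_le (hlim.trans (liminf_le_liminf hba)) le_rfl,
    tendsto_of_le_liminf_of_limsup_le hlim (limsup_le_limsup hba)⟩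

namespace SSEE

open Finset

variable {S : SSEE.{u}} {P : S.DecorationProperty} {N : ℕ}

theorem DecorationProperty.IsHereditary.comp_mem (hP : P.IsHereditary) {n : ℕ} (hNn : N ≤ n)
    {c : S.Decoration n} (hc : c ∈ P.body n) {φ : S.V N ↪ S.V n} (hφ : φ ∈ S.emb N n) :
    c ∘ φ ∈ P.body N := by
  by_contra hcφ
  exact hP N n hNn (Set.mem_iUnion₂.2 ⟨φ, hφ, c ∘ φ, hcφ, fun _ => rfl⟩) hc

theorem IsHomogeneous.exists_isRegularFamily (hS : S.IsHomogeneous) {n : ℕ} (hNn : N ≤ n)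
    [Nonempty (S.V N)] [DecidableEq (S.V n)] :
    ∃ k : ℕ, 0 < k ∧ IsRegularFamily (S.emb N n) k := by
  obtain ⟨k, hk, hdeg⟩ := hS N n hNn inferInstance
  refine ⟨k, hk, fun v => ?_⟩
  rw [← hdeg v, ← Set.ncard_coe_finset]
  simp

theorem totalIntersecting_eq_card_partialOverlaps (S : SSEE.{u}) (N n : ℕ)
    [DecidableEq (S.V n)] : S.totalIntersecting N n = #(partialOverlaps (S.emb N n)) := by
  have hinter : ∀ φ ψ : S.V N ↪ S.V n,
      (Set.range φ ∩ Set.range ψ).ncard = #(univ.map φ ∩ univ.map ψ) := fun φ ψ => by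
    rw [← Set.ncard_coe_finset]
    simp
  rw [totalIntersecting, card_eq_sum_card_fiberwise (f := fun p => #(univ.map p.1 ∩ univ.map p.2))
    (t := Ioo 1 (Fintype.card (S.V N))) fun p hp => by simpa using (mem_filter.1 hp).2]
  refine sum_congr rfl fun i hi => ?_
  rw [intersecting, ← Set.ncard_coe_finset]
  congr 1
  ext p
  have := mem_Ioo.1 hi
  simp only [Set.mem_ofPred_eq, hinter, partialOverlaps, coe_filter, mem_filter, mem_product]
  grind

theorem IsGood.eventually_isSpread (hS : S.IsGood) (hN : 1 < Fintype.card (S.V N))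
    [∀ n, DecidableEq (S.V n)] {σ : ℝ} (hσ : 0 < σ) :
    ∀ᶠ n in atTop, IsSpread (S.emb N n) σ := by
  filter_upwards [(hS.many_embeddings N hN).eventually_gt_atTop σ⁻¹,
    (hS.few_intersections N hN).eventually_lt_const hσ] with n hmany hfew
  have hpos := (inv_pos.2 hσ).trans hmany
  have hV : (0 : ℝ) < Fintype.card (S.V n) :=
    (Nat.cast_nonneg _).lt_of_ne fun h => by simp [← h] at hpos
  have hE : (0 : ℝ) < #(S.emb N n) := (Nat.cast_nonneg _).lt_of_ne fun h => by simp [← h] at hpos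
  rw [totalIntersecting_eq_card_partialOverlaps, div_lt_iff₀ (by positivity)] at hfew
  rw [lt_div_iff₀ hV, inv_mul_lt_iff₀ hσ] at hmany
  exact ⟨hmany.le, hfew.le⟩

theorem coe_le_entropy_iff {n : ℕ} {b : Set (S.Decoration n)} {m : ℝ} :
    (m : EReal) ≤ S.entropy b ↔ volume b ≤ ENNReal.ofReal (Real.exp (-m)) := by
  rw [entropy, EReal.le_neg, ← ENNReal.log_le_log_iff, ENNReal.log_ofReal_of_pos (Real.exp_pos _),
    Real.log_exp, EReal.coe_neg]

theorem coe_lt_entropy_iff {n : ℕ} {b : Set (S.Decoration n)} {m : ℝ} :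
    (m : EReal) < S.entropy b ↔ volume b < ENNReal.ofReal (Real.exp (-m)) := by
  rw [entropy, EReal.lt_neg_comm, ← ENNReal.log_lt_log_iff,
    ENNReal.log_ofReal_of_pos (Real.exp_pos _), Real.log_exp, EReal.coe_neg]

theorem entropy_nonneg {n : ℕ} (b : Set (S.Decoration n)) : 0 ≤ S.entropy b := by
  simpa using (coe_le_entropy_iff (b := b) (m := 0)).2 (by simpa using prob_le_one)

theorem entropy_div_card_nonneg {n : ℕ} (b : Set (S.Decoration n)) :
    0 ≤ S.entropy b / Fintype.card (S.V n) :=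
  EReal.div_nonneg (entropy_nonneg b) (mod_cast Nat.zero_le _)

theorem entropy_body_le_extremalEntropy (P : S.DecorationProperty) (n : ℕ) :
    S.entropy (P.body n) ≤ S.extremalEntropy P n := by
  refine le_sInf ?_
  rintro _ ⟨b, -, hb, rfl⟩
  exact EReal.neg_le_neg_iff.2 (ENNReal.log_le_log_iff.2 (measure_mono_ae (ae_le_set.2 hb)))

theorem volume_pi_lt_of_lt_extremalEntropy {m : ℝ} (hm : (m : EReal) < S.extremalEntropy P N)
    {A : S.V N → Set unitInterval} (hA : ∀ i, MeasurableSet (A i))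
    (hAP : volume (Set.univ.pi A \ P.body N) = 0) :
    volume (Set.univ.pi A) < ENNReal.ofReal (Real.exp (-m)) :=
  coe_lt_entropy_iff.1 <|
    hm.trans_le (sInf_le ⟨_, ⟨A, fun i => (hA i).nullMeasurableSet, rfl⟩, hAP, rfl⟩)

theorem eventually_le_entropy_body (hgood : S.IsGood) (hhom : S.IsHomogeneous)
    (hP : P.IsHereditary) (hN : 1 < Fintype.card (S.V N)) {m η : ℝ} (hm : 0 ≤ m) (hη : 0 < η)
    (hmP : (m : EReal) < S.extremalEntropy P N) :
    ∀ᶠ n in atTop, (((m / Fintype.card (S.V N) - η) * Fintype.card (S.V n) : ℝ) : EReal) ≤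
      S.entropy (P.body n) := by
  classical
  have : Nonempty (S.V N) := Fintype.card_pos_iff.1 (zero_lt_one.trans hN)
  obtain ⟨σ, hσ, hvolume⟩ := exists_pos_forall_measureReal_le.{u} (P.measurable_body N) hm hη
    fun A hA => volume_pi_lt_of_lt_extremalEntropy hmP hA
  filter_upwards [hgood.eventually_isSpread hN hσ, eventually_ge_atTop N] with n hspread hNn
  obtain ⟨k, hk, hregular⟩ := hhom.exists_isRegularFamily hNn
  rw [coe_le_entropy_iff, ENNReal.le_ofReal_iff_toReal_le (measure_ne_top _ _) (Real.exp_pos _).le]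
  exact hvolume _ _ k hk hregular hspread _ fun c hc φ hφ => hP.comp_mem hNn hc hφ

theorem eventually_le_entropy_body_div_card (hgood : S.IsGood) (hhom : S.IsHomogeneous)
    (hP : P.IsHereditary) (hN : 1 < Fintype.card (S.V N)) {c : EReal}
    (hc : c < S.extremalEntropy P N / Fintype.card (S.V N)) :
    ∀ᶠ n in atTop, c ≤ S.entropy (P.body n) / Fintype.card (S.V n) := by
  obtain hc0 | hc0 := lt_or_ge c 0
  · exact Eventually.of_forall fun n => hc0.le.trans (entropy_div_card_nonneg _)
  obtain ⟨d, hcd, hd⟩ := EReal.lt_iff_exists_real_btwn.1 hc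
  obtain ⟨d', hdd', hd'⟩ := EReal.lt_iff_exists_real_btwn.1 hd
  have hd'0 : 0 < d' := EReal.coe_pos.1 ((hc0.trans_lt hcd).trans hdd')
  have hr : (0 : ℝ) < Fintype.card (S.V N) := mod_cast zero_lt_one.trans hN
  have hm : ((d' * Fintype.card (S.V N) : ℝ) : EReal) < S.extremalEntropy P N :=
    (EReal.lt_div_iff (mod_cast hr) (EReal.natCast_ne_top _)).1 hd'
  filter_upwards [hgood.card_tendsto.eventually_gt_atTop 0, eventually_le_entropy_body hgood hhom
    hP hN (by positivity) (sub_pos.2 (EReal.coe_lt_coe_iff.1 hdd')) hm] with n hn hentropy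
  rw [mul_div_cancel_right₀ _ hr.ne', sub_sub_cancel] at hentropy
  exact hcd.le.trans
    ((EReal.le_div_iff_mul_le (mod_cast hn) (EReal.natCast_ne_top _)).2 hentropy)

theorem entropy_div_card_eq_coe {n : ℕ} {b : Set (S.Decoration n)} (hb : volume b ≠ 0) :
    S.entropy b / Fintype.card (S.V n) =
      ((-Real.log (volume.real b) / Fintype.card (S.V n) : ℝ) : EReal) := by
  rw [entropy, ENNReal.log_pos_real hb (measure_ne_top _ _), EReal.coe_div, EReal.coe_neg]
  rfl

theorem entropy_div_card_eq_top {n : ℕ} {b : Set (S.Decoration n)} (hb : volume b = 0)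
    (hn : 0 < Fintype.card (S.V n)) : S.entropy b / Fintype.card (S.V n) = ⊤ := by
  rw [entropy, hb, ENNReal.log_zero, EReal.neg_bot]
  exact EReal.top_div_of_pos_ne_top (mod_cast hn) (EReal.natCast_ne_top _)

theorem ofReal_exp_log_volume {n : ℕ} {b : Set (S.Decoration n)} (hb : volume b ≠ 0) :
    ENNReal.ofReal (Real.exp (Real.log (volume.real b))) = volume b := by
  rw [measureReal_def, Real.exp_log (ENNReal.toReal_pos hb (measure_ne_top _ _)),
    ENNReal.ofReal_toReal (measure_ne_top _ _)]

theorem exists_volume_eq_exp_of_tendsto_entropy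
    (hcard : Tendsto (fun n => Fintype.card (S.V n)) atTop atTop) {b : ∀ n, Set (S.Decoration n)}
    {π : ℝ} (hb : Tendsto (fun n => S.entropy (b n) / Fintype.card (S.V n)) atTop (𝓝 (π : EReal))) :
    ∃ ε : ℕ → ℝ, Tendsto ε atTop (𝓝 0) ∧ ∀ᶠ n in atTop,
      volume (b n) = ENNReal.ofReal (Real.exp (-(π + ε n) * Fintype.card (S.V n))) := by
  have hpos := hcard.eventually_gt_atTop 0
  have hvol : ∀ᶠ n in atTop, volume (b n) ≠ 0 := by
    filter_upwards [hb.eventually_lt_const (EReal.coe_lt_top π), hpos] with n hlt hn hzero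
    exact hlt.ne (entropy_div_card_eq_top hzero hn)
  have hreal : Tendsto (fun n => -Real.log (volume.real (b n)) / Fintype.card (S.V n)) atTop
      (𝓝 π) :=
    EReal.tendsto_coe.1 (hb.congr' (hvol.mono fun n => entropy_div_card_eq_coe))
  refine ⟨fun n => -Real.log (volume.real (b n)) / Fintype.card (S.V n) - π,
    by simpa using hreal.sub_const π, ?_⟩
  filter_upwards [hvol, hpos] with n hn hn0
  have hn0' : (Fintype.card (S.V n) : ℝ) ≠ 0 := mod_cast hn0.ne'
  rw [add_sub_cancel, neg_mul, div_mul_cancel₀ _ hn0', neg_neg, ofReal_exp_log_volume hn]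

theorem exists_volume_le_exp_of_tendsto_entropy_top
    (hcard : Tendsto (fun n => Fintype.card (S.V n)) atTop atTop) {b : ∀ n, Set (S.Decoration n)}
    (hb : Tendsto (fun n => S.entropy (b n) / Fintype.card (S.V n)) atTop (𝓝 ⊤)) :
    ∃ w : ℕ → ℝ, Tendsto (fun n => w n / Fintype.card (S.V n)) atTop atTop ∧
      ∀ᶠ n in atTop, volume (b n) ≤ ENNReal.ofReal (Real.exp (-w n)) := by
  classical
  refine ⟨fun n => if volume (b n) = 0 then n * Fintype.card (S.V n)
    else -Real.log (volume.real (b n)),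
    tendsto_atTop.2 fun t => ?_, Eventually.of_forall fun n => ?_⟩
  · filter_upwards [hb.eventually_const_lt (EReal.coe_lt_top t), hcard.eventually_gt_atTop 0,
      tendsto_natCast_atTop_atTop.eventually_ge_atTop t] with n hlt hn ht
    split_ifs with hzero
    · rwa [mul_div_cancel_right₀ _ (mod_cast hn.ne')]
    · rw [entropy_div_card_eq_coe hzero] at hlt
      exact (EReal.coe_lt_coe_iff.1 hlt).le
  · dsimp only
    split_ifs with hzero
    · simp [hzero]
    · rw [neg_neg, ofReal_exp_log_volume hzero]

end SSEE

theorem mainTheorem3 (S : SSEE.{u}) (hgood : S.IsGood) (hhom : S.IsHomogeneous)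
    (P : S.DecorationProperty) (hP : P.IsHereditary) :
    (∃ π : ℝ,
      Tendsto (fun n => S.extremalEntropy P n / (Fintype.card (S.V n) : EReal)) atTop
        (𝓝 (π : EReal)) ∧
      ∃ ε : ℕ → ℝ, Tendsto ε atTop (𝓝 0) ∧
        ∀ᶠ n in atTop, volume (P.body n) =
          ENNReal.ofReal (Real.exp (-(π + ε n) * (Fintype.card (S.V n) : ℝ)))) ∨
    (Tendsto (fun n => S.extremalEntropy P n / (Fintype.card (S.V n) : EReal)) atTop (𝓝 ⊤) ∧
      ∃ w : ℕ → ℝ, Tendsto (fun n => w n / (Fintype.card (S.V n) : ℝ)) atTop atTop ∧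
        ∀ᶠ n in atTop, volume (P.body n) ≤ ENNReal.ofReal (Real.exp (-w n))) := by
  obtain ⟨π, hex, hvol⟩ := exists_tendsto_of_forall_lt_eventually_le
    (Eventually.of_forall fun n => EReal.div_le_div_right_of_nonneg (mod_cast Nat.zero_le _)
      (SSEE.entropy_body_le_extremalEntropy P n))
    ((hgood.card_tendsto.eventually_gt_atTop 1).mono fun N hN c hc =>
      SSEE.eventually_le_entropy_body_div_card hgood hhom hP hN hc)
  have hπ : 0 ≤ π := ge_of_tendsto' hvol fun _ => SSEE.entropy_div_card_nonneg _
  induction π with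
  | bot => simp at hπ
  | coe π =>
    exact Or.inl ⟨π, hex, SSEE.exists_volume_eq_exp_of_tendsto_entropy hgood.card_tendsto hvol⟩
  | top =>
    exact Or.inr ⟨hex, SSEE.exists_volume_le_exp_of_tendsto_entropy_top hgood.card_tendsto hvol⟩
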